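/- Let $k,l,n,m\ge 1$ be integers, $\delta\in(0,1)$, and let $\sigma(t)=1/(1+e^{-t})$. **Discriminators and generators.** For $\omega=(W_1,\dots,W_{k-1},w_k)$ let $D_\omega=\sigma\circ f_\omega$ with $f_\omega(x)=w_k^{\mathsf T}\,r_{k-1}(W_{k-1}r_{k-2}(\cdots r_1(W_1x)))$, $x\in\mathbb R^d$, and for $\theta=(V_1,\dots,V_l)$ let $g_\theta(z)=V_l\,s_{l-1}(V_{l-1}s_{l-2}(\cdots s_1(V_1z)))\in\mathbb R^d$; the $W_i,V_j$ are real matrices of arbitrary fixed compatible sizes and $w_k$ is a vector. The activation functions $r_i,s_j:\mathbb R\to\mathbb R$ act entrywise, are $R_i$- and $S_j$-Lipschitz, respectively, and are positively homogeneous ($r_i(ct)=c\,r_i(t)$ and $s_j(ct)=c\,s_j(t)$ for $c\ge0$). Let $\Omega$ and $\Theta$ be nonempty sets of such parameters with $\|W_i\|_F\le M_i$ $(i<k)$, $\|w_k\|_2\le M_k$ for all $\omega\in\Omega$ and $\|V_j\|_F\le N_j$ $(j\le l)$ for all $\theta\in\Theta$. **Data.** Let $P_r$ and $P_Z$ be probability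 distributions supported in $\{x:\|x\|_2\le B_x\}$ and $\{z:\|z\|_2\le B_z\}$, respectively. Let $X_1,\dots,X_n$ be i.i.d. from $P_r$ and $Z_1,\dots,Z_m$ i.i.d. from $P_Z$. Let $P_{G_\theta}$ be the law of $g_\theta(Z)$, $Z\sim P_Z$, and let $\hat P_r$, $\hat P_{G_\theta}$ be the empirical distributions of $(X_i)_{i\le n}$ and $(g_\theta(Z_j))_{j\le m}$. **Divergence.** For a class probability estimation (CPE) loss $\ell:\{0,1\}\times[0,1]\to\mathbb R$ put $\phi=-\ell(1,\cdot)$, $\psi=-\ell(0,\cdot)$ and $$d^{(\ell)}(P,Q)=\sup_{\omega\in\Omega}\Big(\mathbb E_{X\sim P}[\phi(D_\omega(X))]+\mathbb E_{X\sim Q}[\psi(D_\omega(X))]\Big)-\phi(\tfrac12)-\psi(\tfrac12).$$ Let $\hat\theta^*$ denote a minimizer of $\theta\mapsto d^{(\ell)}(\hat P_r,\hat P_{G_\theta})$ over $\Theta$. Put $$Q_x=M_k\prod_{i=1}^{k-1}(M_iR_i)\,B_x,\qquad Q_z=\Big(M_k\prod_{i=1}^{k-1}(M_iR_i)\Big)\Big(N_l\prod_{j=1}^{l-1}(N_jS_j)\Big)B_z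 .$$ **(1)** If $\phi$ and $\psi$ are $L_\phi$- and $L_\psi$-Lipschitz on $[0,1]$, then with probability at least $1-2\delta$ over the training samples, every minimizer $\hat\theta^*$ satisfies $$d^{(\ell)}(P_r,P_{G_{\hat\theta^*}})-\inf_{\theta\in\Theta}d^{(\ell)}(P_r,P_{G_\theta})\le\frac{L_\phi Q_x\sqrt{3k}}{\sqrt n}+\frac{L_\psi Q_z\sqrt{3(k+l-1)}}{\sqrt m}+\sqrt{\log\tfrac1\delta}\Big(\frac{L_\phi Q_x}{\sqrt{2n}}+\frac{L_\psi Q_z}{\sqrt{2m}}\Big).$$ **(2)** ($\alpha$-GAN) Let $\alpha\in(0,\infty]$ and let $\ell=\ell_\alpha$ be the $\alpha$-loss, $\ell_\alpha(1,t)=\ell_\alpha(0,1-t)=\frac{\alpha}{\alpha-1}\big(1-t^{\frac{\alpha-1}{\alpha}}\big)$, read as $-\log t$ for $\alpha=1$ and as $1-t$ for $\alpha=\infty$. (No Lipschitz assumption is made here.) Then with probability at least $1-2\delta$ over the training samples, every minimizer $\hat\theta^*$ satisfies $$d^{(\ell_\alpha)}(P_r,P_{G_{\hat\theta^*}})-\inf_{\theta\in\Theta}d^{(\ell_\alpha)}(P_r,P_{G_\theta})\le\frac{4C_{Q_x}(\alpha)Q_x\sqrt{3k}}{\sqrt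 n}+\frac{4C_{Q_z}(\alpha)Q_z\sqrt{3(k+l-1)}}{\sqrt m}+2\sqrt{2\log\tfrac1\delta}\Big(\frac{C_{Q_x}(\alpha)Q_x}{\sqrt n}+\frac{C_{Q_z}(\alpha)Q_z}{\sqrt m}\Big),$$ where $$C_h(\alpha)=\begin{cases}\sigma(h)\,\sigma(-h)^{\frac{\alpha-1}{\alpha}},&\alpha\in(0,1],\\[2pt]\Big(\frac{\alpha-1}{2\alpha-1}\Big)^{\frac{\alpha-1}{\alpha}}\frac{\alpha}{2\alpha-1},&\alpha\in(1,\infty),\\[2pt]\frac14,&\alpha=\infty.\end{cases}$$ -/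

import Mathlib

open MeasureTheory ProbabilityTheory
open scoped NNReal ENNReal

noncomputable section

namespace CPEGAN

/-! ### Feed-forward networks -/

/-- Weight matrices of `h` hidden layers with layer widths `p 0` (input), `p 1`, …, `p h`:
the matrix with index `i` (counted from zero) maps `ℝ^(p i)` to `ℝ^(p (i + 1))`. -/
abbrev HiddenWeights (p : ℕ → ℕ) (h : ℕ) : Type :=
  ∀ i : Fin h, Matrix (Fin (p (i + 1))) (Fin (p i)) ℝ

/-- The map `x ↦ r_h (W_h r_{h-1} (W_{h-1} ⋯ r_1 (W_1 x)))`, where the activation functions act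
entrywise. For `h = 0` it is the identity. -/
def hiddenMap (p : ℕ → ℕ) : (h : ℕ) → (Fin h → ℝ → ℝ) → HiddenWeights p h →
    EuclideanSpace ℝ (Fin (p 0)) → EuclideanSpace ℝ (Fin (p h))
  | 0, _, _, x => x
  | h + 1, r, W, x =>
      WithLp.toLp 2 fun a : Fin (p (h + 1)) =>
        r (Fin.last h) (Matrix.mulVec (W (Fin.last h))
          (hiddenMap p h (fun i => r i.castSucc) (fun i => W i.castSucc) x).ofLp a)

/-- Parameters `ω = (W_1, …, W_{k-1}, w_k)` of a discriminator with `k` layers. -/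
abbrev DiscParam (p : ℕ → ℕ) (k : ℕ) : Type :=
  HiddenWeights p (k - 1) × EuclideanSpace ℝ (Fin (p (k - 1)))

/-- `f_ω(x) = w_kᵀ r_{k-1}(W_{k-1} r_{k-2}(⋯ r_1(W_1 x)))`. -/
def discLogit (p : ℕ → ℕ) (k : ℕ) (r : Fin (k - 1) → ℝ → ℝ) (ω : DiscParam p k)
    (x : EuclideanSpace ℝ (Fin (p 0))) : ℝ :=
  inner ℝ ω.2 (hiddenMap p (k - 1) r ω.1 x)

/-- The discriminator `D_ω = σ ∘ f_ω` with `σ(t) = 1 / (1 + e^{-t})`. -/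
def disc (p : ℕ → ℕ) (k : ℕ) (r : Fin (k - 1) → ℝ → ℝ) (ω : DiscParam p k)
    (x : EuclideanSpace ℝ (Fin (p 0))) : ℝ :=
  Real.sigmoid (discLogit p k r ω x)

/-- Parameters `θ = (V_1, …, V_l)` of a generator with `l` layers and output in `ℝ^d`. -/
abbrev GenParam (q : ℕ → ℕ) (l d : ℕ) : Type :=
  HiddenWeights q (l - 1) × Matrix (Fin d) (Fin (q (l - 1))) ℝ

/-- `g_θ(z) = V_l s_{l-1}(V_{l-1} s_{l-2}(⋯ s_1(V_1 z)))`. -/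
def gen (q : ℕ → ℕ) (l d : ℕ) (s : Fin (l - 1) → ℝ → ℝ) (θ : GenParam q l d)
    (z : EuclideanSpace ℝ (Fin (q 0))) : EuclideanSpace ℝ (Fin d) :=
  WithLp.toLp 2 (Matrix.mulVec θ.2 (hiddenMap q (l - 1) s θ.1 z).ofLp)

/-- Positive homogeneity of an activation function. -/
def PosHomogeneous (r : ℝ → ℝ) : Prop := ∀ c : ℝ, 0 ≤ c → ∀ t : ℝ, r (c * t) = c * r t

section Frobenius

open scoped Matrix.Norms.Frobenius

/-- All discriminator parameters with `‖W_i‖_F ≤ M_i` for `i < k` and `‖w_k‖₂ ≤ M_k`. -/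
def discBall (p : ℕ → ℕ) (k : ℕ) (M : Fin (k - 1) → ℝ) (Mk : ℝ) : Set (DiscParam p k) :=
  {ω | (∀ i, ‖ω.1 i‖ ≤ M i) ∧ ‖ω.2‖ ≤ Mk}

/-- All generator parameters with `‖V_j‖_F ≤ N_j` for `j ≤ l`. -/
def genBall (q : ℕ → ℕ) (l d : ℕ) (N : Fin (l - 1) → ℝ) (Nl : ℝ) : Set (GenParam q l d) :=
  {θ | (∀ j, ‖θ.1 j‖ ≤ N j) ∧ ‖θ.2‖ ≤ Nl}

end Frobenius

/-! ### CPE losses and the induced divergence -/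

/-- A class probability estimation loss `ℓ(y, ŷ)`, for a label `y ∈ {0, 1}` and a soft
prediction `ŷ ∈ [0, 1]`. -/
abbrev CPELoss : Type := Fin 2 → ℝ → ℝ

/-- `d^{(ℓ)}(P, Q) = sup_{ω ∈ Ω} (E_P[φ(D_ω(X))] + E_Q[ψ(D_ω(X))]) - φ(1/2) - ψ(1/2)`
with `φ = -ℓ(1, ·)` and `ψ = -ℓ(0, ·)`. -/
def lossDiv (ℓ : CPELoss) {E Ω : Type*} [MeasurableSpace E] (D : Ω → E → ℝ) (S : Set Ω)
    (P Q : Measure E) : ℝ :=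
  (⨆ ω : S, ((∫ x, -ℓ 1 (D ω x) ∂P) + ∫ x, -ℓ 0 (D ω x) ∂Q)) - (-ℓ 1 (1 / 2)) - (-ℓ 0 (1 / 2))

/-- The empirical distribution of `n` points. -/
def empirical {E : Type*} [MeasurableSpace E] {n : ℕ} (x : Fin n → E) : Measure E :=
  (n : ℝ≥0∞)⁻¹ • ∑ i, Measure.dirac (x i)

/-- The `α`-loss, `α ∈ (0, ∞]`, evaluated at the probability `t > 0` assigned to the true label;
the cases `α = 1` (log-loss) and `α = ∞` are the continuous extensions. -/
def alphaPartialLoss (α : ℝ≥0∞) (t : ℝ) : ℝ :=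
  if α = 1 then -Real.log t
  else if α = ⊤ then 1 - t
  else α.toReal / (α.toReal - 1) * (1 - t ^ ((α.toReal - 1) / α.toReal))

/-- The `α`-loss as a CPE loss: `ℓ_α(1, ŷ)` is the partial loss at `ŷ` and `ℓ_α(0, ŷ)` the one at
`1 - ŷ`. -/
def alphaLoss (α : ℝ≥0∞) : CPELoss := fun y t => alphaPartialLoss α (if y = 1 then t else 1 - t)

/-- The constant `C_h(α)`; its value `1/4` at `α = ∞` is the limit. -/
def lipConst (h : ℝ) (α : ℝ≥0∞) : ℝ :=
  if α ≤ 1 then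
    Real.sigmoid h * Real.sigmoid (-h) ^ ((α.toReal - 1) / α.toReal)
  else if α = ⊤ then 1 / 4
  else ((α.toReal - 1) / (2 * α.toReal - 1)) ^ ((α.toReal - 1) / α.toReal) *
    (α.toReal / (2 * α.toReal - 1))

/-- With probability at least `1 - 2δ` over the samples, every minimizer `θ̂` over `Θ` of the
empirical objective `θ ↦ d(P̂_r, P̂_{G_θ})` has estimation error
`d(P_r, P_{G_θ̂}) - inf_{θ ∈ Θ} d(P_r, P_{G_θ})` at most `bound`. Here `P_{G_θ}` is the law of
`g_θ(Z)` with `Z ∼ P_Z`, and `P̂_r`, `P̂_{G_θ}` are the empirical distributions of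
`X_1, …, X_n` and of `g_θ(Z_1), …, g_θ(Z_m)`. -/
def EstimationErrorBound (ℓ : CPELoss) {E F ΩD ΘG S : Type*} [MeasurableSpace E]
    [MeasurableSpace F] [MeasurableSpace S]
    (D : ΩD → E → ℝ) (Ω : Set ΩD) (g : ΘG → F → E) (Θ : Set ΘG)
    (Pr : Measure E) (PZ : Measure F) (μ : Measure S)
    {n m : ℕ} (X : Fin n → S → E) (Z : Fin m → S → F) (δ bound : ℝ) : Prop :=
  ∃ A : Set S, MeasurableSet A ∧ 1 - 2 * δ ≤ μ.real A ∧
    ∀ t ∈ A, ∀ θhat ∈ Θ,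
      IsMinOn (fun θ => lossDiv ℓ D Ω (empirical fun i => X i t) (empirical fun j => g θ (Z j t)))
        Θ θhat →
      lossDiv ℓ D Ω Pr (PZ.map (g θhat)) - ⨅ θ : Θ, lossDiv ℓ D Ω Pr (PZ.map (g θ)) ≤ bound

end CPEGAN

end

/-!
The estimation error of an empirical minimizer is at most the sum of the oscillations, over `ω` and
over `(ω, θ)`, of the deviation between the population and the empirical mean of `φ ∘ D_ω` and of
`ψ ∘ D_ω ∘ g_θ`. Each supremum of deviations concentrates around its expectation by McDiarmid's
inequality, and symmetrization bounds this expectation by a Rademacher complexity.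

Since `φ ∘ σ` and `ψ ∘ σ` are Lipschitz on the range of the logits, the contraction principle
reduces the Rademacher complexity to that of the networks themselves. Working with the exponential
moment of the Rademacher supremum rather than with its expectation makes peeling off a layer cheap:
by positive homogeneity and the contraction principle, a layer only contributes its norm bound, its
Lipschitz constant and a factor `2` outside the exponential. For `K` hidden layers, Jensen's
inequality turns the factor `2 ^ K` into a term `K log 2` under a square root, whence the constants
`√(3k)` and `√(3(k + l - 1))` in place of factors exponential in the depth.
-/

noncomputable section

namespace CPEGAN

/-! ### Sign patterns -/

section Signs

variable {κ : Type*} [DecidableEq κ]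

/-- Flips the `j`-th sign of the sign pattern `ε`. -/
def flipSign (j : κ) (ε : κ → ℤˣ) : κ → ℤˣ := Function.update ε j (-ε j)

lemma flipSign_self (j : κ) (ε : κ → ℤˣ) : flipSign j ε j = -ε j :=
  Function.update_self ..

lemma flipSign_of_ne {j c : κ} (h : c ≠ j) (ε : κ → ℤˣ) : flipSign j ε c = ε c :=
  Function.update_of_ne h ..

lemma flipSign_involutive (j : κ) : Function.Involutive (flipSign j) := fun ε => by
  simp [flipSign]

lemma sum_add_flipSign [Fintype κ] {A : Type*} [AddCommMonoid A] (j : κ) (f : (κ → ℤˣ) → A) :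
    ∑ ε, (f ε + f (flipSign j ε)) = 2 • ∑ ε, f ε := by
  rw [Finset.sum_add_distrib, (flipSign_involutive j).bijective.sum_comp f, two_nsmul]

variable {V : Type*} [AddCommGroup V]

lemma sum_flipSign_smul_of_notMem {j : κ} {F : Finset κ} (hj : j ∉ F) (ε : κ → ℤˣ) (v : κ → V) :
    ∑ c ∈ F, flipSign j ε c • v c = ∑ c ∈ F, ε c • v c :=
  Finset.sum_congr rfl fun c hc => by rw [flipSign_of_ne (ne_of_mem_of_not_mem hc hj)]

lemma sum_smul_eq_erase_add [Fintype κ] (j : κ) (ε : κ → ℤˣ) (v : κ → V) :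
    ∑ c, ε c • v c = (∑ c ∈ Finset.univ.erase j, ε c • v c) + ε j • v j :=
  (Finset.sum_erase_add _ _ (Finset.mem_univ j)).symm

lemma sum_flipSign_smul [Fintype κ] (j : κ) (ε : κ → ℤˣ) (v : κ → V) :
    ∑ c, flipSign j ε c • v c = (∑ c ∈ Finset.univ.erase j, ε c • v c) - ε j • v j := by
  rw [sum_smul_eq_erase_add j, flipSign_self, Units.neg_smul, ← sub_eq_add_neg,
    sum_flipSign_smul_of_notMem (Finset.notMem_erase j _)]

lemma abs_units_smul (u : ℤˣ) (x : ℝ) : |u • x| = |x| := norm_units_zsmul u x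

end Signs

/-! ### The contraction principle for exponential moments -/

lemma convexOn_add_sub_le_add_sub {f : ℝ → ℝ} {s : Set ℝ} (hf : ConvexOn ℝ s f) {a b c : ℝ}
    (hb : |b| ≤ c) (hadd : a + c ∈ s) (hsub : a - c ∈ s) :
    f (a + b) + f (a - b) ≤ f (a + c) + f (a - c) := by
  obtain rfl | hc := ((abs_nonneg b).trans hb).eq_or_lt
  · rw [abs_nonpos_iff.1 hb]
  obtain ⟨hb₁, hb₂⟩ := abs_le.1 hb
  have hp : 0 ≤ (c + b) / (2 * c) := div_nonneg (by linarith) (by linarith)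
  have hq : 0 ≤ (c - b) / (2 * c) := div_nonneg (by linarith) (by linarith)
  have hpq : (c + b) / (2 * c) + (c - b) / (2 * c) = 1 := by field_simp; ring
  have hplus := hf.2 hadd hsub hp hq hpq
  have hminus := hf.2 hadd hsub hq hp ((add_comm _ _).trans hpq)
  simp only [smul_eq_mul] at hplus hminus
  rw [show (c + b) / (2 * c) * (a + c) + (c - b) / (2 * c) * (a - c) = a + b by field_simp; ring]
    at hplus
  rw [show (c - b) / (2 * c) * (a + c) + (c + b) / (2 * c) * (a - c) = a - b by field_simp; ring]
    at hminus
  calc f (a + b) + f (a - b)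
      ≤ ((c + b) / (2 * c) + (c - b) / (2 * c)) * (f (a + c) + f (a - c)) := by linarith
    _ = f (a + c) + f (a - c) := by rw [hpq, one_mul]

lemma exp_add_sub_exp_le {u v h h' : ℝ} (huv : u ≤ v) (hh : h ≤ h') (h0 : 0 ≤ h) :
    Real.exp (u + h) - Real.exp u ≤ Real.exp (v + h') - Real.exp v := by
  have := mul_le_mul (Real.exp_le_exp.2 huv) (sub_le_sub_right (Real.exp_le_exp.2 hh) 1)
    (sub_nonneg.2 (Real.one_le_exp h0)) (Real.exp_pos v).le
  simpa only [Real.exp_add, mul_sub, mul_one] using this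

lemma exp_add_exp_sub_le_of_sub_le_sub {a b x x' y y' U : ℝ} (hx' : |x'| ≤ y')
    (hxx : x - x' ≤ y - y') (hU : Real.exp (a + y) ≤ U) (hU' : Real.exp (b + y') ≤ U) :
    Real.exp (a + x) + Real.exp (b - x') ≤ U + Real.exp (b - y') := by
  obtain ⟨hx'₁, hx'₂⟩ := abs_le.1 hx'
  rcases lt_or_ge (a + x) (b + x') with hlt | hle
  · have hconv := convexOn_add_sub_le_add_sub convexOn_exp (a := b) hx' trivial trivial
    linarith [Real.exp_lt_exp.2 hlt]
  · have hincr := exp_add_sub_exp_le (u := b - y') (v := a + x) (h := y' - x') (h' := y - x)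
      (by linarith) (by linarith) (by linarith)
    rw [sub_add_sub_cancel, add_add_sub_cancel] at hincr
    linarith

/-- Talagrand's two-point comparison: `U` and `V` play the role of the suprema of the two
exponentials on the dominating side. -/
lemma exp_add_exp_sub_le_of_contraction {a b x x' y y' U V : ℝ} (hx : |x| ≤ |y|)
    (hx' : |x'| ≤ |y'|) (hxx : |x - x'| ≤ |y - y'|) (hU : Real.exp (a + y) ≤ U)
    (hU' : Real.exp (b + y') ≤ U) (hV : Real.exp (a - y) ≤ V) (hV' : Real.exp (b - y') ≤ V) :
    Real.exp (a + x) + Real.exp (b - x') ≤ U + V := by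
  wlog hyy : y' ≤ y generalizing a b x x' y y'
  · have := this (x := -x') (x' := -x) (by rwa [abs_neg]) (by rwa [abs_neg])
      (by rwa [neg_sub_neg, abs_sub_comm y']) hU' hU hV' hV (le_of_not_ge hyy)
    rwa [← sub_eq_add_neg, sub_neg_eq_add, add_comm] at this
  have hsub : x - x' ≤ y - y' := by
    simpa only [abs_of_nonneg (sub_nonneg.2 hyy)] using (abs_le.1 hxx).2
  rcases le_total 0 y' with hy' | hy'
  · rw [abs_of_nonneg hy'] at hx'
    exact (exp_add_exp_sub_le_of_sub_le_sub hx' hsub hU hU').trans (by gcongr)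
  rw [abs_of_nonpos hy'] at hx'
  rcases le_total 0 y with hy | hy
  · rw [abs_of_nonneg hy] at hx
    have hle : Real.exp (a + x) ≤ Real.exp (a + y) := by gcongr; exact (abs_le.1 hx).2
    have hle' : Real.exp (b - x') ≤ Real.exp (b - y') := by gcongr; linarith [(abs_le.1 hx').1]
    linarith
  · rw [abs_of_nonpos hy] at hx
    have := exp_add_exp_sub_le_of_sub_le_sub (a := b) (b := a) (x := -x') (x' := -x) (y := -y')
      (y' := -y) (U := V) (by rwa [abs_neg]) (by linarith) hV' hV
    rw [← sub_eq_add_neg, sub_neg_eq_add, sub_neg_eq_add] at this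
    linarith

lemma iSup_exp_add_iSup_exp_le_of_contraction {ι : Type*} [Nonempty ι] (a x y : ι → ℝ)
    (h : ∀ i, |x i| ≤ |y i|) (h' : ∀ i j, |x i - x j| ≤ |y i - y j|) :
    (⨆ i, ENNReal.ofReal (Real.exp (a i + x i))) + (⨆ i, ENNReal.ofReal (Real.exp (a i - x i)))
      ≤ (⨆ i, ENNReal.ofReal (Real.exp (a i + y i)))
        + ⨆ i, ENNReal.ofReal (Real.exp (a i - y i)) := by
  refine ENNReal.iSup_add_iSup_le fun i j => ?_
  rcases eq_or_ne (⨆ i, ENNReal.ofReal (Real.exp (a i + y i))) ⊤ with hU | hU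
  · simp [hU]
  rcases eq_or_ne (⨆ i, ENNReal.ofReal (Real.exp (a i - y i))) ⊤ with hV | hV
  · simp [hV]
  have le_U (i : ι) := (ENNReal.ofReal_le_iff_le_toReal hU).1
    (le_iSup (fun i => ENNReal.ofReal (Real.exp (a i + y i))) i)
  have le_V (i : ι) := (ENNReal.ofReal_le_iff_le_toReal hV).1
    (le_iSup (fun i => ENNReal.ofReal (Real.exp (a i - y i))) i)
  rw [← ENNReal.ofReal_toReal hU, ← ENNReal.ofReal_toReal hV,
    ← ENNReal.ofReal_add (Real.exp_pos _).le (Real.exp_pos _).le,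
    ← ENNReal.ofReal_add ENNReal.toReal_nonneg ENNReal.toReal_nonneg]
  exact ENNReal.ofReal_le_ofReal (exp_add_exp_sub_le_of_contraction (h i) (h j) (h' i j)
    (le_U i) (le_U j) (le_V i) (le_V j))

section Contraction

variable {ι κ : Type*} [Fintype κ] [DecidableEq κ]

/-- The exponential moment `∑_ε sup_i exp (∑_c ε_c v_{i,c})` of the Rademacher process with
coefficients `v`, as a sum rather than an average over the sign patterns. It takes values in
`[0, ∞]` so that no boundedness of the index family is needed. -/
def expMoment (v : ι → κ → ℝ) : ℝ≥0∞ :=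
  ∑ ε : κ → ℤˣ, ⨆ i, ENNReal.ofReal (Real.exp (∑ c, ε c • v i c))

lemma expMoment_comp_le {ι' : Type*} (v : ι → κ → ℝ) (e : ι' → ι) :
    expMoment (fun i => v (e i)) ≤ expMoment v :=
  Finset.sum_le_sum fun ε _ =>
    iSup_comp_le (fun i => ENNReal.ofReal (Real.exp (∑ c, ε c • v i c))) e

lemma expMoment_le_update [Nonempty ι] (v : ι → κ → ℝ) (j : κ) (w : ι → ℝ)
    (h : ∀ i, |v i j| ≤ |w i|) (h' : ∀ i i', |v i j - v i' j| ≤ |w i - w i'|) :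
    expMoment v ≤ expMoment fun i => Function.update (v i) j (w i) := by
  have hoff (ε : κ → ℤˣ) (i : ι) :
      (∑ c ∈ Finset.univ.erase j, ε c • Function.update (v i) j (w i) c)
        = ∑ c ∈ Finset.univ.erase j, ε c • v i c :=
    Finset.sum_congr rfl fun c hc => by rw [Function.update_of_ne (Finset.ne_of_mem_erase hc)]
  refine (ENNReal.mul_le_mul_iff_right two_ne_zero ENNReal.ofNat_ne_top).1 ?_
  rw [expMoment, expMoment, ← Nat.cast_ofNat, ← nsmul_eq_mul, ← nsmul_eq_mul,
    ← sum_add_flipSign j, ← sum_add_flipSign j]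
  refine Finset.sum_le_sum fun ε _ => ?_
  simp only [sum_smul_eq_erase_add j ε, sum_flipSign_smul j, hoff, Function.update_self]
  refine iSup_exp_add_iSup_exp_le_of_contraction _ _ _ (fun i => ?_) fun i i' => ?_
  · simpa only [abs_units_smul] using h i
  · simpa only [← smul_sub, abs_units_smul] using h' i i'

lemma expMoment_le_of_contraction [Nonempty ι] (v w : ι → κ → ℝ) (h : ∀ i c, |v i c| ≤ |w i c|)
    (h' : ∀ i i' c, |v i c - v i' c| ≤ |w i c - w i' c|) : expMoment v ≤ expMoment w := by
  have replace_on (F : Finset κ) :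
      expMoment v ≤ expMoment fun i c => if c ∈ F then w i c else v i c := by
    induction F using Finset.induction_on with
    | empty => simp
    | insert j F hj ih =>
      refine ih.trans ((expMoment_le_update _ j (fun i => w i j) ?_ ?_).trans_eq ?_)
      · intro i; simpa only [hj, if_false] using h i j
      · intro i i'; simpa only [hj, if_false] using h' i i' j
      · congr 1; ext i c
        by_cases hc : c = j
        · subst hc; simp
        · simp [hc]
  simpa only [Finset.mem_univ, if_true] using replace_on Finset.univ

lemma expMoment_mul_comp_le [Nonempty ι] {h : ℝ → ℝ} {C : ℝ≥0} {s : Set ℝ}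
    (hLip : LipschitzOnWith C h s) (hs : 0 ∈ s) (h0 : h 0 = 0) {v : ι → κ → ℝ}
    (hv : ∀ i c, v i c ∈ s) (a : ℝ) :
    expMoment (fun i c => a * h (v i c)) ≤ expMoment fun i c => a * C * v i c := by
  have hdist {t t' : ℝ} (ht : t ∈ s) (ht' : t' ∈ s) :
      |a * h t - a * h t'| ≤ |a * C * t - a * C * t'| := by
    rw [← mul_sub, ← mul_sub, abs_mul, mul_assoc, abs_mul, abs_mul, NNReal.abs_eq]
    gcongr
    exact hLip.dist_le_mul t ht t' ht'
  refine expMoment_le_of_contraction _ _ (fun i c => ?_) fun i i' c => hdist (hv i c) (hv i' c)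
  simpa only [h0, mul_zero, sub_zero] using hdist (hv i c) hs

end Contraction

/-! ### Exponential moments of Rademacher sums in a Hilbert space -/

section HilbertSpace

variable {H : Type*} [NormedAddCommGroup H] [InnerProductSpace ℝ H]

lemma cosh_norm_add_add_cosh_norm_sub_le (s x : H) :
    Real.cosh ‖s + x‖ + Real.cosh ‖s - x‖ ≤ 2 * (Real.cosh ‖s‖ * Real.cosh ‖x‖) := by
  have hprod : 2 * (Real.cosh ‖s‖ * Real.cosh ‖x‖)
      = Real.cosh (‖s‖ + ‖x‖) + Real.cosh (‖s‖ - ‖x‖) := by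
    rw [Real.cosh_add, Real.cosh_sub]; ring
  rw [hprod]
  -- The even power series of `cosh` reduces the claim to convexity of `t ↦ t ^ k` at `‖s ± x‖²`.
  refine hasSum_le (fun k => ?_) ((Real.hasSum_cosh _).add (Real.hasSum_cosh _))
    ((Real.hasSum_cosh _).add (Real.hasSum_cosh _))
  rw [← add_div, ← add_div]
  refine div_le_div_of_nonneg_right ?_ (Nat.cast_nonneg _)
  have hinner : |2 * inner ℝ s x| ≤ 2 * ‖s‖ * ‖x‖ := by
    rw [abs_mul, abs_two, mul_assoc]
    gcongr
    exact abs_real_inner_le_norm s x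
  have hconv := convexOn_add_sub_le_add_sub (convexOn_pow k) (a := ‖s‖ ^ 2 + ‖x‖ ^ 2) hinner
    (Set.mem_Ici.2 (by positivity)) (Set.mem_Ici.2 (by nlinarith [sq_nonneg (‖s‖ - ‖x‖)]))
  simpa only [pow_mul, norm_add_sq_real, norm_sub_sq_real, add_sq, sub_sq,
    add_right_comm _ _ (‖x‖ ^ 2), sub_add_eq_add_sub] using hconv

variable {κ : Type*} [Fintype κ] [DecidableEq κ]

lemma sum_cosh_norm_le (x : κ → H) (F : Finset κ) :
    ∑ ε : κ → ℤˣ, Real.cosh ‖∑ c ∈ F, ε c • x c‖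
      ≤ 2 ^ Fintype.card κ * ∏ c ∈ F, Real.cosh ‖x c‖ := by
  induction F using Finset.induction_on with
  | empty => simp
  | insert j F hj ih =>
    have hpair (ε : κ → ℤˣ) :
        Real.cosh ‖∑ c ∈ insert j F, ε c • x c‖
          + Real.cosh ‖∑ c ∈ insert j F, flipSign j ε c • x c‖
        ≤ 2 * (Real.cosh ‖∑ c ∈ F, ε c • x c‖ * Real.cosh ‖x j‖) := by
      rw [Finset.sum_insert hj, Finset.sum_insert hj, sum_flipSign_smul_of_notMem hj,
        flipSign_self, Units.neg_smul, add_comm, neg_add_eq_sub, add_comm (ε j • x j), add_comm,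
        ← norm_units_zsmul (ε j) (x j)]
      exact cosh_norm_add_add_cosh_norm_sub_le _ _
    have hsum := Finset.sum_le_sum fun ε (_ : ε ∈ Finset.univ) => hpair ε
    rw [sum_add_flipSign j fun ε => Real.cosh ‖∑ c ∈ insert j F, ε c • x c‖, nsmul_eq_mul,
      Nat.cast_ofNat, ← Finset.mul_sum, ← Finset.sum_mul] at hsum
    calc ∑ ε : κ → ℤˣ, Real.cosh ‖∑ c ∈ insert j F, ε c • x c‖
        ≤ (∑ ε : κ → ℤˣ, Real.cosh ‖∑ c ∈ F, ε c • x c‖) * Real.cosh ‖x j‖ := by linarith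
      _ ≤ (2 ^ Fintype.card κ * ∏ c ∈ F, Real.cosh ‖x c‖) * Real.cosh ‖x j‖ := by
          gcongr
      _ = 2 ^ Fintype.card κ * ∏ c ∈ insert j F, Real.cosh ‖x c‖ := by
          rw [Finset.prod_insert hj]; ring

lemma exp_le_two_mul_cosh (t : ℝ) : Real.exp t ≤ 2 * Real.cosh t := by
  rw [Real.cosh_eq]
  linarith [Real.exp_pos (-t)]

lemma sum_exp_norm_le (x : κ → H) {B : ℝ} (hx : ∀ c, ‖x c‖ ≤ B) (a : ℝ) :
    ∑ ε : κ → ℤˣ, Real.exp (a * ‖∑ c, ε c • x c‖)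
      ≤ 2 ^ (Fintype.card κ + 1) * Real.exp (a ^ 2 * B ^ 2 * Fintype.card κ / 2) := by
  have hcosh (ε : κ → ℤˣ) :
      Real.exp (a * ‖∑ c, ε c • x c‖) ≤ 2 * Real.cosh ‖∑ c, ε c • a • x c‖ := by
    simp only [smul_comm _ a, ← Finset.smul_sum, norm_smul]
    refine (exp_le_two_mul_cosh _).trans_eq ?_
    rw [← Real.cosh_abs, abs_mul, abs_norm, Real.norm_eq_abs]
  have hprod : ∏ c, Real.cosh ‖a • x c‖ ≤ Real.exp (a ^ 2 * B ^ 2 * Fintype.card κ / 2) := by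
    calc ∏ c, Real.cosh ‖a • x c‖ ≤ ∏ _c : κ, Real.exp (a ^ 2 * B ^ 2 / 2) := by
          refine Finset.prod_le_prod (fun _ _ => (Real.cosh_pos _).le) fun c _ =>
            (Real.cosh_le_exp_half_sq _).trans ?_
          rw [norm_smul, mul_pow, Real.norm_eq_abs, sq_abs]
          gcongr
          exact hx c
      _ = Real.exp (a ^ 2 * B ^ 2 * Fintype.card κ / 2) := by
          rw [Finset.prod_const, ← Real.exp_nat_mul, Finset.card_univ]
          ring_nf
  calc ∑ ε : κ → ℤˣ, Real.exp (a * ‖∑ c, ε c • x c‖)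
      ≤ 2 * ∑ ε : κ → ℤˣ, Real.cosh ‖∑ c, ε c • a • x c‖ := by
        rw [Finset.mul_sum]; exact Finset.sum_le_sum fun ε _ => hcosh ε
    _ ≤ 2 * (2 ^ Fintype.card κ * Real.exp (a ^ 2 * B ^ 2 * Fintype.card κ / 2)) := by
        gcongr
        exact (sum_cosh_norm_le (fun c => a • x c) Finset.univ).trans (by gcongr)
    _ = 2 ^ (Fintype.card κ + 1) * Real.exp (a ^ 2 * B ^ 2 * Fintype.card κ / 2) := by ring

end HilbertSpace

/-! ### From exponential moments to Rademacher complexities -/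

section RademacherComplexity

lemma ofReal_exp_ciSup_le {ι : Type*} [Nonempty ι] (y : ι → ℝ) :
    ENNReal.ofReal (Real.exp (⨆ i, y i)) ≤ ⨆ i, ENNReal.ofReal (Real.exp (y i)) := by
  rcases eq_or_ne (⨆ i, ENNReal.ofReal (Real.exp (y i))) ⊤ with htop | htop
  · simp [htop]
  have hle (i : ι) := (ENNReal.ofReal_le_iff_le_toReal htop).1
    (le_iSup (fun i => ENNReal.ofReal (Real.exp (y i))) i)
  have hpos := (Real.exp_pos _).trans_le (hle (Classical.arbitrary ι))
  rw [ENNReal.ofReal_le_iff_le_toReal htop, ← Real.le_log_iff_exp_le hpos]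
  exact ciSup_le fun i => (Real.le_log_iff_exp_le hpos).2 (hle i)

lemma le_mul_sqrt_of_forall_mul_le {ρ q K : ℝ} (hq : 0 ≤ q) (hK : 0 < K)
    (h : ∀ a : ℝ, 0 < a → a * ρ ≤ K * Real.log 2 + a ^ 2 * q ^ 2 / 2) :
    ρ ≤ q * √(3 * K) := by
  have hlog : Real.log 2 < 1 := by linarith [Real.log_two_lt_d9]
  rcases hq.eq_or_lt with rfl | hq
  · rw [zero_mul]
    by_contra! hρ
    have := h (K / ρ) (by positivity)
    rw [div_mul_cancel₀ _ hρ.ne'] at this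
    nlinarith
  have hs : 0 < √K := Real.sqrt_pos.2 hK
  -- The choice of `a` balancing the two terms up to the factor `√(2 log 2)`.
  have hopt := h (√K / q) (by positivity)
  rw [div_pow, div_mul_cancel₀ _ (by positivity), div_mul_eq_mul_div, div_le_iff₀ hq] at hopt
  have hρ : ρ ≤ q * √K * (Real.log 2 + 1 / 2) := by
    refine le_of_mul_le_mul_left (hopt.trans_eq ?_) hs
    linear_combination q * (-Real.log 2) * Real.sq_sqrt hK.le
  have hnum : Real.log 2 + 1 / 2 ≤ √3 :=
    Real.le_sqrt_of_sq_le (by nlinarith [Real.log_two_lt_d9, Real.log_two_gt_d9])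
  calc ρ ≤ q * √K * √3 := hρ.trans (by gcongr)
    _ = q * √(3 * K) := by rw [Real.sqrt_mul (by norm_num)]; ring

variable {κ : Type*} [Fintype κ] [DecidableEq κ]

lemma exp_mul_sum_div_le (a : ℝ) (Y : (κ → ℤˣ) → ℝ) :
    Real.exp (a * ((∑ ε, Y ε) / 2 ^ Fintype.card κ))
      ≤ (∑ ε, Real.exp (a * Y ε)) / 2 ^ Fintype.card κ := by
  have hJensen := convexOn_exp.map_sum_le (t := (Finset.univ : Finset (κ → ℤˣ)))
    (w := fun _ => (2 ^ Fintype.card κ : ℝ)⁻¹) (p := fun ε => a * Y ε) (fun _ _ => by positivity)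
    (by simp) fun _ _ => Set.mem_univ _
  simp only [smul_eq_mul, ← Finset.mul_sum] at hJensen
  refine (le_of_eq ?_).trans (hJensen.trans_eq ?_)
  · congr 1; ring
  · ring

/-- The Rademacher complexity `E_ε sup_i ∑_c ε_c v_{i,c}` of the family of vectors `v_i`; it is not
normalised by the number of coordinates. -/
def rademacherComplexity {ι : Type*} (v : ι → κ → ℝ) : ℝ :=
  (∑ ε : κ → ℤˣ, ⨆ i, ∑ c, ε c • v i c) / 2 ^ Fintype.card κ

variable {ι : Type*}

lemma ofReal_sum_exp_mul_iSup_le [Nonempty ι] (v : ι → κ → ℝ) {a : ℝ} (ha : 0 ≤ a) :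
    ENNReal.ofReal (∑ ε : κ → ℤˣ, Real.exp (a * ⨆ i, ∑ c, ε c • v i c))
      ≤ expMoment fun i c => a * v i c := by
  rw [ENNReal.ofReal_sum_of_nonneg fun _ _ => (Real.exp_pos _).le]
  refine Finset.sum_le_sum fun ε _ => ?_
  simp only [Real.mul_iSup_of_nonneg ha, Finset.mul_sum, mul_smul_comm]
  exact ofReal_exp_ciSup_le _

variable {H : Type*} [NormedAddCommGroup H]

/-- The exponential Rademacher moments of the function class `f` are dominated, up to a factor
`2 ^ K`, by those of the Rademacher sums of the inputs scaled by `A`. For a class of neural networks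
`A` is the product of the weight and Lipschitz bounds and `K` counts the hidden layers. -/
def HasExpMomentBound (f : ι → H → ℝ) (A : ℝ) (K : ℕ) : Prop :=
  ∀ ⦃n : ℕ⦄ ⦃a : ℝ⦄, 0 ≤ a → ∀ x : Fin n → H, expMoment (fun i c => a * f i (x c))
    ≤ 2 ^ K * ∑ ε : Fin n → ℤˣ, ENNReal.ofReal (Real.exp (a * A * ‖∑ c, ε c • x c‖))

namespace HasExpMomentBound

variable {f : ι → H → ℝ} {A : ℝ} {K : ℕ}

lemma comp {ι' : Type*} (hf : HasExpMomentBound f A K) (e : ι' → ι) :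
    HasExpMomentBound (fun i => f (e i)) A K := fun _ a ha x =>
  (expMoment_comp_le (fun i c => a * f i (x c)) e).trans (hf ha x)

lemma abs_le (hf : HasExpMomentBound f A K) (i : ι) (x : H) : |f i x| ≤ A * ‖x‖ := by
  suffices h : ∀ u : ℤˣ, u • f i x - A * ‖x‖ ≤ 0 by
    have h₁ := h 1
    have h₂ := h (-1)
    rw [one_smul] at h₁
    rw [Units.neg_smul, one_smul] at h₂
    exact abs_le'.2 ⟨by linarith, by linarith⟩
  intro u
  refine (le_mul_sqrt_of_forall_mul_le (q := 0) (K := K + 1) le_rfl (by positivity)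
    fun a ha => ?_).trans_eq (zero_mul _)
  have hle : ENNReal.ofReal (Real.exp (a * u • f i x))
      ≤ ENNReal.ofReal (2 ^ (K + 1) * Real.exp (a * (A * ‖x‖))) := by
    calc ENNReal.ofReal (Real.exp (a * u • f i x))
        ≤ expMoment fun i (_ : Fin 1) => a * f i x := by
          refine le_trans ?_ (Finset.single_le_sum (fun _ _ => zero_le)
            (Finset.mem_univ fun _ => u))
          refine le_trans (le_of_eq ?_) (le_iSup _ i)
          simp [mul_smul_comm]
      _ ≤ _ := hf ha.le fun _ => x
      _ = ENNReal.ofReal (2 ^ (K + 1) * Real.exp (a * (A * ‖x‖))) := by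
          simp [norm_units_zsmul, ENNReal.ofReal_mul, ENNReal.ofReal_pow, pow_succ, mul_assoc]
  rw [ENNReal.ofReal_le_ofReal_iff (by positivity),
    ← Real.le_log_iff_exp_le (by positivity), Real.log_mul (by positivity) (Real.exp_ne_zero _),
    Real.log_exp, Real.log_pow] at hle
  push_cast at hle
  linarith

variable {B : ℝ} {C : ℝ≥0} {h : ℝ → ℝ} {n : ℕ}

lemma apply_mem_closedBall (hf : HasExpMomentBound f A K) (hA : 0 ≤ A) (i : ι) {x : H}
    (hx : ‖x‖ ≤ B) : f i x ∈ Metric.closedBall (0 : ℝ) (A * B) :=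
  mem_closedBall_zero_iff.2 ((hf.abs_le i x).trans (by gcongr))

lemma expMoment_comp_lipschitz_le [Nonempty ι] (hf : HasExpMomentBound f A K) (hA : 0 ≤ A)
    (hB : 0 ≤ B) (h0 : h 0 = 0) (hLip : LipschitzOnWith C h (Metric.closedBall 0 (A * B)))
    {x : Fin n → H} (hx : ∀ c, ‖x c‖ ≤ B) {a : ℝ} (ha : 0 ≤ a) :
    expMoment (fun i c => a * h (f i (x c)))
      ≤ 2 ^ K * ∑ ε : Fin n → ℤˣ, ENNReal.ofReal (Real.exp (a * C * A * ‖∑ c, ε c • x c‖)) :=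
  (expMoment_mul_comp_le hLip (Metric.mem_closedBall_self (by positivity)) h0
    (fun i c => hf.apply_mem_closedBall hA i (hx c)) a).trans (hf (by positivity) x)

variable [InnerProductSpace ℝ H]

lemma rademacherComplexity_comp_le [Nonempty ι] (hf : HasExpMomentBound f A K) (hA : 0 ≤ A)
    (hB : 0 ≤ B) (h0 : h 0 = 0) (hLip : LipschitzOnWith C h (Metric.closedBall 0 (A * B)))
    {x : Fin n → H} (hx : ∀ c, ‖x c‖ ≤ B) :
    rademacherComplexity (fun i c => h (f i (x c))) ≤ C * (A * B) * √n * √(3 * (K + 1)) := by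
  refine le_mul_sqrt_of_forall_mul_le (by positivity) (by positivity) fun a ha => ?_
  have hmoment : ENNReal.ofReal (∑ ε : Fin n → ℤˣ, Real.exp (a * ⨆ i, ∑ c, ε c • h (f i (x c))))
      ≤ ENNReal.ofReal (2 ^ K * (2 ^ (n + 1) * Real.exp ((a * C * A) ^ 2 * B ^ 2 * n / 2))) := by
    refine (ofReal_sum_exp_mul_iSup_le _ ha.le).trans
      ((hf.expMoment_comp_lipschitz_le hA hB h0 hLip hx ha.le).trans ?_)
    rw [← ENNReal.ofReal_sum_of_nonneg fun _ _ => (Real.exp_pos _).le,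
      ENNReal.ofReal_mul (by positivity), ENNReal.ofReal_pow zero_le_two, ENNReal.ofReal_ofNat]
    gcongr
    simpa only [Fintype.card_fin] using sum_exp_norm_le x hx (a * C * A)
  rw [ENNReal.ofReal_le_ofReal_iff (by positivity)] at hmoment
  rw [← Real.exp_le_exp]
  calc Real.exp (a * rademacherComplexity fun i c => h (f i (x c)))
      ≤ (∑ ε : Fin n → ℤˣ, Real.exp (a * ⨆ i, ∑ c, ε c • h (f i (x c)))) / 2 ^ n := by
        simpa only [rademacherComplexity, Fintype.card_fin] using
          exp_mul_sum_div_le a fun ε : Fin n → ℤˣ => ⨆ i, ∑ c, ε c • h (f i (x c))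
    _ ≤ 2 ^ K * (2 ^ (n + 1) * Real.exp ((a * C * A) ^ 2 * B ^ 2 * n / 2)) / 2 ^ n := by gcongr
    _ = 2 ^ (K + 1) * Real.exp ((a * C * A) ^ 2 * B ^ 2 * n / 2) := by field_simp; ring
    _ = Real.exp ((K + 1) * Real.log 2 + a ^ 2 * (C * (A * B) * √n) ^ 2 / 2) := by
        have htwo : Real.exp ((K + 1) * Real.log 2) = 2 ^ (K + 1) := by
          rw [← Nat.cast_add_one, Real.exp_nat_mul, Real.exp_log two_pos]
        rw [Real.exp_add, htwo, mul_pow _ √(n : ℝ), Real.sq_sqrt (Nat.cast_nonneg n)]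
        ring_nf

end HasExpMomentBound

end RademacherComplexity

/-! ### Peeling off the layers of a network -/

lemma PosHomogeneous.map_zero {r : ℝ → ℝ} (hr : PosHomogeneous r) : r 0 = 0 := by
  simpa only [zero_mul] using hr 0 le_rfl 0

lemma PosHomogeneous.apply_inner {H : Type*} [NormedAddCommGroup H] [InnerProductSpace ℝ H]
    {r : ℝ → ℝ} (hr : PosHomogeneous r) (v x : H) :
    r (inner ℝ v x) = ‖v‖ * r (inner ℝ (‖v‖⁻¹ • v) x) := by
  rcases eq_or_ne v 0 with rfl | hv
  · simp [hr.map_zero]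
  · rw [← hr _ (norm_nonneg v), real_inner_smul_left, mul_inv_cancel_left₀ (norm_ne_zero_iff.2 hv)]

section Layer

open scoped Matrix.Norms.Frobenius

variable {d d' : Type*}

/-- The `a`-th row of a matrix as a vector of Euclidean space. -/
def euclideanRow (W : Matrix d' d ℝ) (a : d') : EuclideanSpace ℝ d := WithLp.toLp 2 (W a)

variable [Fintype d]

lemma mulVec_eq_inner_euclideanRow (W : Matrix d' d ℝ) (x : EuclideanSpace ℝ d) (a : d') :
    W.mulVec x.ofLp a = inner ℝ (euclideanRow W a) x := by
  simp [euclideanRow, Matrix.mulVec, dotProduct, PiLp.inner_apply, mul_comm]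

/-- A network layer: the matrix `W` followed by the activation function `r` in each entry. -/
def layer (r : ℝ → ℝ) (W : Matrix d' d ℝ) (x : EuclideanSpace ℝ d) : EuclideanSpace ℝ d' :=
  WithLp.toLp 2 fun a => r (W.mulVec x.ofLp a)

variable {κ : Type*} [Fintype κ] {r : ℝ → ℝ}

lemma sum_smul_layer_apply (hr : PosHomogeneous r) (W : Matrix d' d ℝ)
    (x : κ → EuclideanSpace ℝ d) (ε : κ → ℤˣ) (a : d') :
    (∑ c, ε c • layer r W (x c)) a = ‖euclideanRow W a‖
      * ∑ c, ε c • r (inner ℝ (‖euclideanRow W a‖⁻¹ • euclideanRow W a) (x c)) := by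
  simp only [WithLp.ofLp_sum, Finset.sum_apply, Finset.mul_sum, mul_smul_comm, ← hr.apply_inner,
    ← mulVec_eq_inner_euclideanRow]
  rfl

variable [Fintype d']

lemma frobenius_norm_sq_eq_sum_euclideanRow (W : Matrix d' d ℝ) :
    ‖W‖ ^ 2 = ∑ a, ‖euclideanRow W a‖ ^ 2 := by
  rw [Matrix.frobenius_norm_def, ← Real.sqrt_eq_rpow, Real.sq_sqrt (by positivity)]
  simp only [EuclideanSpace.norm_sq_eq, euclideanRow, Real.rpow_ofNat]

lemma norm_le_of_abs_le_norm_euclideanRow_mul (W : Matrix d' d ℝ) {T : ℝ} (hT : 0 ≤ T)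
    {y : EuclideanSpace ℝ d'} (hy : ∀ a, |y a| ≤ ‖euclideanRow W a‖ * T) : ‖y‖ ≤ ‖W‖ * T := by
  refine le_of_sq_le_sq ?_ (by positivity)
  rw [EuclideanSpace.norm_sq_eq, mul_pow, frobenius_norm_sq_eq_sum_euclideanRow, Finset.sum_mul]
  refine Finset.sum_le_sum fun a _ => ?_
  rw [← mul_pow]
  exact pow_le_pow_left₀ (norm_nonneg _) (hy a) 2

lemma norm_mulVec_le_frobenius_norm_mul (W : Matrix d' d ℝ) (x : EuclideanSpace ℝ d) :
    ‖(WithLp.toLp 2 (W.mulVec x.ofLp) : EuclideanSpace ℝ d')‖ ≤ ‖W‖ * ‖x‖ :=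
  norm_le_of_abs_le_norm_euclideanRow_mul W (norm_nonneg x) fun a => by
    rw [WithLp.ofLp_toLp, mulVec_eq_inner_euclideanRow]; exact abs_real_inner_le_norm _ _

lemma exists_norm_sum_smul_layer_le (hr : PosHomogeneous r) (W : Matrix d' d ℝ)
    (x : κ → EuclideanSpace ℝ d) (ε : κ → ℤˣ) :
    ∃ w : EuclideanSpace ℝ d, ‖w‖ ≤ 1 ∧
      ‖∑ c, ε c • layer r W (x c)‖ ≤ ‖W‖ * |∑ c, ε c • r (inner ℝ w (x c))| := by
  rcases isEmpty_or_nonempty d' with hd | hd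
  · refine ⟨0, norm_zero.trans_le zero_le_one, ?_⟩
    rw [Subsingleton.elim (∑ c, ε c • layer r W (x c)) 0, norm_zero]
    positivity
  let u (a : d') : EuclideanSpace ℝ d := ‖euclideanRow W a‖⁻¹ • euclideanRow W a
  obtain ⟨a₀, ha₀⟩ := Finite.exists_max fun a => |∑ c, ε c • r (inner ℝ (u a) (x c))|
  refine ⟨u a₀, ?_, norm_le_of_abs_le_norm_euclideanRow_mul W (abs_nonneg _) fun a => ?_⟩
  · rw [norm_smul, norm_inv, norm_norm]
    exact inv_mul_le_one
  · rw [sum_smul_layer_apply hr, abs_mul, abs_norm]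
    exact mul_le_mul_of_nonneg_left (ha₀ a) (norm_nonneg _)

end Layer

section NormExpMoment

variable {ι κ H : Type*} [Fintype κ] [DecidableEq κ] [NormedAddCommGroup H]

/-- The exponential moment `∑_ε sup_i exp (a ‖∑_c ε_c u_{i,c}‖)` of a vector-valued Rademacher
process, the analogue of `expMoment`. -/
def normExpMoment (a : ℝ) (u : ι → κ → H) : ℝ≥0∞ :=
  ∑ ε : κ → ℤˣ, ⨆ i, ENNReal.ofReal (Real.exp (a * ‖∑ c, ε c • u i c‖))

lemma expMoment_mul_inner_le [InnerProductSpace ℝ H] {ι' : Type*} (a : ℝ) {b : ℝ} {w : ι' → H}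
    (hw : ∀ j, ‖w j‖ ≤ b) (e : ι' → ι) (u : ι → κ → H) :
    expMoment (fun j c => a * inner ℝ (w j) (u (e j) c)) ≤ normExpMoment (|a| * b) u := by
  refine Finset.sum_le_sum fun ε _ => iSup_le fun j => le_iSup_of_le (e j) ?_
  have hlin : ∑ c, ε c • (a * inner ℝ (w j) (u (e j) c))
      = a * inner ℝ (w j) (∑ c, ε c • u (e j) c) := by
    simp only [inner_sum, Finset.mul_sum, Units.smul_def, ← Int.cast_smul_eq_zsmul ℝ,
      real_inner_smul_right, smul_eq_mul, mul_left_comm a]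
  gcongr
  calc _ ≤ |a * inner ℝ (w j) (∑ c, ε c • u (e j) c)| := hlin.trans_le (le_abs_self _)
    _ ≤ |a| * (‖w j‖ * ‖∑ c, ε c • u (e j) c‖) := by
        rw [abs_mul]; gcongr; exact abs_real_inner_le_norm _ _
    _ ≤ |a| * b * ‖∑ c, ε c • u (e j) c‖ := by
        rw [mul_assoc]; gcongr; exact hw j

lemma ofReal_exp_abs_le (t : ℝ) :
    ENNReal.ofReal (Real.exp |t|)
      ≤ ENNReal.ofReal (Real.exp t) + ENNReal.ofReal (Real.exp (-t)) := by
  rcases abs_choice t with ht | ht <;> rw [ht]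
  exacts [le_self_add, le_add_self]

open scoped Matrix.Norms.Frobenius in
lemma normExpMoment_layer_le [Nonempty ι] {d d' : Type*} [Fintype d] [Fintype d'] {r : ℝ → ℝ}
    (hr : PosHomogeneous r) {R : ℝ≥0} (hL : LipschitzWith R r) {W : ι → Matrix d' d ℝ} {M : ℝ}
    (hW : ∀ i, ‖W i‖ ≤ M) (u : ι → κ → EuclideanSpace ℝ d) {a : ℝ} (ha : 0 ≤ a) :
    normExpMoment a (fun i c => layer r (W i) (u i c)) ≤ 2 * normExpMoment (a * (M * R)) u := by
  have hM : 0 ≤ M := (norm_nonneg (W (Classical.arbitrary ι))).trans (hW _)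
  -- The supremum over `i` is enlarged to one over all normalised neurons fed by the inputs `u i`.
  let J := ι × Metric.closedBall (0 : EuclideanSpace ℝ d) 1
  have : Nonempty (Metric.closedBall (0 : EuclideanSpace ℝ d) 1) :=
    ⟨0, Metric.mem_closedBall_self zero_le_one⟩
  have hneurons (b : ℝ) : expMoment (fun (j : J) c => b * r (inner ℝ j.2.1 (u j.1 c)))
      ≤ normExpMoment (|b| * R) u := by
    refine (expMoment_mul_comp_le hL.lipschitzOnWith (Set.mem_univ 0) hr.map_zero
      (fun _ _ => Set.mem_univ _) b).trans ((expMoment_mul_inner_le (b * R)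
        (fun j => mem_closedBall_zero_iff.1 j.2.2) Prod.fst u).trans_eq ?_)
    rw [abs_mul, NNReal.abs_eq, mul_one]
  have hsplit : normExpMoment a (fun i c => layer r (W i) (u i c))
      ≤ expMoment (fun (j : J) c => a * M * r (inner ℝ j.2.1 (u j.1 c)))
        + expMoment (fun (j : J) c => -(a * M) * r (inner ℝ j.2.1 (u j.1 c))) := by
    unfold normExpMoment expMoment
    rw [← Finset.sum_add_distrib]
    refine Finset.sum_le_sum fun ε _ => iSup_le fun i => ?_
    obtain ⟨w, hw, hle⟩ := exists_norm_sum_smul_layer_le hr (W i) (u i) ε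
    let j : J := (i, ⟨w, mem_closedBall_zero_iff.2 hw⟩)
    simp only [← mul_smul_comm, ← Finset.mul_sum]
    calc ENNReal.ofReal (Real.exp (a * ‖∑ c, ε c • layer r (W i) (u i c)‖))
        ≤ ENNReal.ofReal (Real.exp |a * M * ∑ c, ε c • r (inner ℝ w (u i c))|) := by
          rw [abs_mul, abs_of_nonneg (mul_nonneg ha hM), mul_assoc]
          gcongr
          exact hle.trans (by gcongr; exact hW i)
      _ ≤ _ := by
          refine (ofReal_exp_abs_le _).trans ?_
          rw [← neg_mul]
          exact add_le_add (le_iSup_of_le j le_rfl) (le_iSup_of_le j le_rfl)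
  refine hsplit.trans ((add_le_add (hneurons _) (hneurons _)).trans_eq ?_)
  rw [abs_neg, abs_of_nonneg (mul_nonneg ha hM), mul_assoc, two_mul]

end NormExpMoment

section Network

lemma hiddenMap_succ (p : ℕ → ℕ) (h : ℕ) (r : Fin (h + 1) → ℝ → ℝ) (W : HiddenWeights p (h + 1))
    (x : EuclideanSpace ℝ (Fin (p 0))) :
    hiddenMap p (h + 1) r W x = layer (r (Fin.last h)) (W (Fin.last h))
      (hiddenMap p h (fun i => r i.castSucc) (fun i => W i.castSucc) x) := rfl

section ExpMoment

open scoped Matrix.Norms.Frobenius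

variable {ι κ : Type*} [Fintype κ]

lemma norm_sum_smul_gen_le {q : ℕ → ℕ} {l d : ℕ} (s : Fin (l - 1) → ℝ → ℝ) (θ : GenParam q l d)
    (z : κ → EuclideanSpace ℝ (Fin (q 0))) (ε : κ → ℤˣ) :
    ‖∑ c, ε c • gen q l d s θ (z c)‖ ≤ ‖θ.2‖ * ‖∑ c, ε c • hiddenMap q (l - 1) s θ.1 (z c)‖ := by
  convert norm_mulVec_le_frobenius_norm_mul θ.2
    (∑ c, ε c • hiddenMap q (l - 1) s θ.1 (z c)) using 2
  simp only [gen, Units.smul_def, ← Int.cast_smul_eq_zsmul ℝ, WithLp.ofLp_sum, WithLp.ofLp_smul,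
    Matrix.mulVec_sum, Matrix.mulVec_smul, WithLp.toLp_sum, WithLp.toLp_smul]

variable [Nonempty ι] [DecidableEq κ]

lemma normExpMoment_hiddenMap_le {p : ℕ → ℕ} {h : ℕ} {r : Fin h → ℝ → ℝ} {R : Fin h → ℝ≥0}
    (hL : ∀ i, LipschitzWith (R i) (r i)) (hr : ∀ i, PosHomogeneous (r i)) {M : Fin h → ℝ}
    {W : ι → HiddenWeights p h} (hW : ∀ i j, ‖W i j‖ ≤ M j)
    (u : ι → κ → EuclideanSpace ℝ (Fin (p 0))) {a : ℝ} (ha : 0 ≤ a) :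
    normExpMoment a (fun i c => hiddenMap p h r (W i) (u i c))
      ≤ 2 ^ h * normExpMoment (a * ∏ j, M j * R j) u := by
  induction h generalizing a with
  | zero => simp [hiddenMap]
  | succ h ih =>
    have hM : 0 ≤ M (Fin.last h) :=
      (norm_nonneg (W (Classical.arbitrary ι) (Fin.last h))).trans (hW _ _)
    simp only [hiddenMap_succ]
    calc _ ≤ 2 * normExpMoment (a * (M (Fin.last h) * R (Fin.last h))) (fun i c =>
            hiddenMap p h (fun j => r j.castSucc) (fun j => W i j.castSucc) (u i c)) :=
          normExpMoment_layer_le (hr _) (hL _) (fun i => hW i (Fin.last h)) _ ha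
      _ ≤ 2 * (2 ^ h * normExpMoment (a * (M (Fin.last h) * R (Fin.last h))
            * ∏ j : Fin h, M j.castSucc * R j.castSucc) u) := by
          gcongr
          exact ih (fun j => hL j.castSucc) (fun j => hr j.castSucc)
            (fun i j => hW i j.castSucc) (by positivity)
      _ = 2 ^ (h + 1) * normExpMoment (a * ∏ j, M j * R j) u := by
          rw [Fin.prod_univ_castSucc, pow_succ', mul_assoc 2, mul_assoc a, mul_comm (∏ _, _)]

lemma expMoment_discLogit_le {p : ℕ → ℕ} {k : ℕ} {r : Fin (k - 1) → ℝ → ℝ}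
    {R : Fin (k - 1) → ℝ≥0} (hL : ∀ i, LipschitzWith (R i) (r i))
    (hr : ∀ i, PosHomogeneous (r i)) {M : Fin (k - 1) → ℝ} {Mk : ℝ} {ω : ι → DiscParam p k}
    (hω : ∀ i, ω i ∈ discBall p k M Mk) (u : ι → κ → EuclideanSpace ℝ (Fin (p 0)))
    {a : ℝ} (ha : 0 ≤ a) :
    expMoment (fun i c => a * discLogit p k r (ω i) (u i c))
      ≤ 2 ^ (k - 1) * normExpMoment (a * (Mk * ∏ i, M i * R i)) u := by
  have hMk : 0 ≤ Mk := (norm_nonneg (ω (Classical.arbitrary ι)).2).trans (hω _).2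
  refine (expMoment_mul_inner_le a (fun i => (hω i).2) id
    fun i c => hiddenMap p (k - 1) r (ω i).1 (u i c)).trans ?_
  rw [abs_of_nonneg ha, ← mul_assoc a]
  exact normExpMoment_hiddenMap_le hL hr (fun i => (hω i).1) u (by positivity)

lemma normExpMoment_gen_le {q : ℕ → ℕ} {l d : ℕ} {s : Fin (l - 1) → ℝ → ℝ}
    {S : Fin (l - 1) → ℝ≥0} (hL : ∀ j, LipschitzWith (S j) (s j))
    (hs : ∀ j, PosHomogeneous (s j)) {N : Fin (l - 1) → ℝ} {Nl : ℝ} {θ : ι → GenParam q l d}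
    (hθ : ∀ i, θ i ∈ genBall q l d N Nl) (u : ι → κ → EuclideanSpace ℝ (Fin (q 0)))
    {a : ℝ} (ha : 0 ≤ a) :
    normExpMoment a (fun i c => gen q l d s (θ i) (u i c))
      ≤ 2 ^ (l - 1) * normExpMoment (a * (Nl * ∏ j, N j * S j)) u := by
  have hNl : 0 ≤ Nl := (norm_nonneg (θ (Classical.arbitrary ι)).2).trans (hθ _).2
  calc normExpMoment a (fun i c => gen q l d s (θ i) (u i c))
      ≤ normExpMoment (a * Nl) (fun i c => hiddenMap q (l - 1) s (θ i).1 (u i c)) := by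
        refine Finset.sum_le_sum fun ε _ => iSup_mono fun i => ?_
        rw [mul_assoc]
        gcongr
        exact (norm_sum_smul_gen_le s (θ i) (u i) ε).trans (by gcongr; exact (hθ i).2)
    _ ≤ 2 ^ (l - 1) * normExpMoment (a * (Nl * ∏ j, N j * S j)) u := by
        rw [← mul_assoc a]
        exact normExpMoment_hiddenMap_le hL hs (fun i => (hθ i).1) u (by positivity)

lemma normExpMoment_const {H : Type*} [NormedAddCommGroup H] (a : ℝ) (x : κ → H) :
    normExpMoment a (fun _ : ι => x)
      = ∑ ε : κ → ℤˣ, ENNReal.ofReal (Real.exp (a * ‖∑ c, ε c • x c‖)) := by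
  simp only [normExpMoment, iSup_const]

variable {p : ℕ → ℕ} {k : ℕ} {r : Fin (k - 1) → ℝ → ℝ} {R : Fin (k - 1) → ℝ≥0}
  {M : Fin (k - 1) → ℝ} {Mk : ℝ} {ω : ι → DiscParam p k}

lemma hasExpMomentBound_discLogit (hL : ∀ i, LipschitzWith (R i) (r i))
    (hr : ∀ i, PosHomogeneous (r i)) (hω : ∀ i, ω i ∈ discBall p k M Mk) :
    HasExpMomentBound (fun i => discLogit p k r (ω i)) (Mk * ∏ i, M i * R i) (k - 1) :=
  fun n a ha x => by
    simpa only [normExpMoment_const] using expMoment_discLogit_le hL hr hω (fun _ => x) ha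

lemma mul_prod_nonneg_of_mem_discBall {ω : DiscParam p k} (hω : ω ∈ discBall p k M Mk)
    (R : Fin (k - 1) → ℝ≥0) : 0 ≤ Mk * ∏ i, M i * R i :=
  mul_nonneg ((norm_nonneg _).trans hω.2)
    (Finset.prod_nonneg fun i _ => mul_nonneg ((norm_nonneg _).trans (hω.1 i)) (R i).2)

variable {q : ℕ → ℕ} {l d : ℕ} {s : Fin (l - 1) → ℝ → ℝ} {S : Fin (l - 1) → ℝ≥0}
  {N : Fin (l - 1) → ℝ} {Nl : ℝ}

lemma mul_prod_nonneg_of_mem_genBall {θ : GenParam q l d} (hθ : θ ∈ genBall q l d N Nl)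
    (S : Fin (l - 1) → ℝ≥0) : 0 ≤ Nl * ∏ j, N j * S j :=
  mul_nonneg ((norm_nonneg θ.2).trans hθ.2)
    (Finset.prod_nonneg fun j _ => mul_nonneg ((norm_nonneg _).trans (hθ.1 j)) (S j).2)

lemma hasExpMomentBound_discLogit_gen (hLr : ∀ i, LipschitzWith (R i) (r i))
    (hr : ∀ i, PosHomogeneous (r i)) (hω : ∀ i, ω i ∈ discBall p k M Mk)
    (hLs : ∀ j, LipschitzWith (S j) (s j)) (hs : ∀ j, PosHomogeneous (s j))
    {θ : ι → GenParam q l (p 0)} (hθ : ∀ i, θ i ∈ genBall q l (p 0) N Nl) :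
    HasExpMomentBound (fun i z => discLogit p k r (ω i) (gen q l (p 0) s (θ i) z))
      ((Mk * ∏ i, M i * R i) * (Nl * ∏ j, N j * S j)) (k - 1 + (l - 1)) := by
  intro n a ha z
  have hA := mul_prod_nonneg_of_mem_discBall (hω (Classical.arbitrary ι)) R
  refine (expMoment_discLogit_le hLr hr hω (fun i c => gen q l (p 0) s (θ i) (z c)) ha).trans ?_
  rw [pow_add, mul_assoc, ← mul_assoc a (Mk * _)]
  gcongr
  simpa only [normExpMoment_const] using
    normExpMoment_gen_le hLs hs hθ (fun _ => z) (mul_nonneg ha hA)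

end ExpMoment

section Continuity

variable {T : Type*} [TopologicalSpace T]

lemma continuous_hiddenMap {p : ℕ → ℕ} {h : ℕ} {r : Fin h → ℝ → ℝ} (hr : ∀ i, Continuous (r i))
    {W : T → HiddenWeights p h} (hW : Continuous W) {x : T → EuclideanSpace ℝ (Fin (p 0))}
    (hx : Continuous x) : Continuous fun t => hiddenMap p h r (W t) (x t) := by
  induction h with
  | zero => exact hx
  | succ h ih =>
    have hprev : Continuous fun t => hiddenMap p h (fun i => r i.castSucc)
        (fun i => W t i.castSucc) (x t) := ih (fun _ => hr _) (by fun_prop)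
    simp only [hiddenMap_succ, layer]
    refine (PiLp.continuous_toLp 2 _).comp (continuous_pi fun a => (hr _).comp ?_)
    exact (continuous_apply a).comp (Continuous.matrix_mulVec (by fun_prop) (by fun_prop))

lemma continuous_discLogit {p : ℕ → ℕ} {k : ℕ} {r : Fin (k - 1) → ℝ → ℝ}
    (hr : ∀ i, Continuous (r i)) {ω : T → DiscParam p k} (hω : Continuous ω)
    {x : T → EuclideanSpace ℝ (Fin (p 0))} (hx : Continuous x) :
    Continuous fun t => discLogit p k r (ω t) (x t) :=
  hω.snd.inner (continuous_hiddenMap hr hω.fst hx)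

lemma continuous_gen {q : ℕ → ℕ} {l d : ℕ} {s : Fin (l - 1) → ℝ → ℝ} (hs : ∀ j, Continuous (s j))
    {θ : T → GenParam q l d} (hθ : Continuous θ) {z : T → EuclideanSpace ℝ (Fin (q 0))}
    (hz : Continuous z) : Continuous fun t => gen q l d s (θ t) (z t) :=
  (PiLp.continuous_toLp 2 _).comp (hθ.snd.matrix_mulVec
    ((PiLp.continuous_ofLp 2 _).comp (continuous_hiddenMap hs hθ.fst hz)))

instance {m n α : Type*} [Countable m] [Countable n] [TopologicalSpace α]
    [SecondCountableTopology α] : SecondCountableTopology (Matrix m n α) :=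
  inferInstanceAs (SecondCountableTopology (m → n → α))

end Continuity

end Network

/-! ### The bounded differences inequality -/

section BoundedDifferences

variable {α β : Type*} [MeasurableSpace α] [MeasurableSpace β] {μ : Measure α} {ν : Measure β}

lemma hasSubgaussianMGF_add_prod [SFinite μ] [IsFiniteMeasure ν] {X : α → ℝ} {Y : α × β → ℝ}
    {cX cY : ℝ≥0} (hX : HasSubgaussianMGF X cX μ) (hYm : Measurable Y)
    (hY : ∀ x, HasSubgaussianMGF (fun y => Y (x, y)) cY ν) :
    HasSubgaussianMGF (fun z => X z.1 + Y z) (cX + cY) (μ.prod ν) := by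
  have hsplit (t : ℝ) (z : α × β) :
      Real.exp (t * (X z.1 + Y z)) = Real.exp (t * X z.1) * Real.exp (t * Y z) := by
    rw [mul_add, Real.exp_add]
  have hinner (t : ℝ) (x : α) : ∫ y, Real.exp (t * (X x + Y (x, y))) ∂ν
      ≤ Real.exp (t * X x) * Real.exp (cY * t ^ 2 / 2) := by
    simp only [hsplit t (x, _), integral_const_mul]
    gcongr
    exact (hY x).mgf_le t
  have hint (t : ℝ) : Integrable (fun z => Real.exp (t * (X z.1 + Y z))) (μ.prod ν) := by
    have hmeas : AEStronglyMeasurable (fun z => Real.exp (t * (X z.1 + Y z))) (μ.prod ν) :=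
      ((hX.aemeasurable.comp_fst.add hYm.aemeasurable).const_mul t).exp.aestronglyMeasurable
    refine (integrable_prod_iff hmeas).2 ⟨.of_forall fun x => ?_, ?_⟩
    · simpa only [hsplit t (x, _)] using ((hY x).integrable_exp_mul t).const_mul _
    · refine ((hX.integrable_exp_mul t).mul_const (Real.exp (cY * t ^ 2 / 2))).mono'
        hmeas.norm.integral_prod_right' (.of_forall fun x => ?_)
      simp only [Real.norm_eq_abs, Real.abs_exp]
      exact (abs_of_nonneg (by positivity)).trans_le (hinner t x)
  refine ⟨hint, fun t => ?_⟩
  calc mgf (fun z => X z.1 + Y z) (μ.prod ν) t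
      = ∫ x, ∫ y, Real.exp (t * (X x + Y (x, y))) ∂ν ∂μ := integral_prod _ (hint t)
    _ ≤ ∫ x, Real.exp (t * X x) * Real.exp (cY * t ^ 2 / 2) ∂μ :=
        integral_mono (hint t).integral_prod_left ((hX.integrable_exp_mul t).mul_const _) (hinner t)
    _ ≤ Real.exp (cX * t ^ 2 / 2) * Real.exp (cY * t ^ 2 / 2) := by
        rw [integral_mul_const]
        gcongr
        exact hX.mgf_le t
    _ = Real.exp ((cX + cY : ℝ≥0) * t ^ 2 / 2) := by
        rw [← Real.exp_add, NNReal.coe_add]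
        ring_nf

lemma hasSubgaussianMGF_sub_integral_of_abs_sub_le [IsProbabilityMeasure μ] {X : α → ℝ}
    (hX : AEMeasurable X μ) {c : ℝ≥0} (hc : ∀ x y, |X x - X y| ≤ c) :
    HasSubgaussianMGF (fun x => X x - ∫ y, X y ∂μ) ((c / 2) ^ 2) μ := by
  have : Nonempty α := nonempty_of_isProbabilityMeasure μ
  have hbelow (x y : α) : X x - c ≤ X y := by linarith [(abs_le.1 (hc x y)).2]
  have hbdd : BddBelow (Set.range X) :=
    ⟨X (Classical.arbitrary α) - c, Set.forall_mem_range.2 (hbelow _)⟩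
  have h := hasSubgaussianMGF_of_mem_Icc hX (.of_forall fun x =>
    ⟨ciInf_le hbdd x, sub_le_iff_le_add.1 (le_ciInf (hbelow x))⟩)
  rwa [add_sub_cancel_left, NNReal.nnnorm_eq] at h

lemma hasSubgaussianMGF_sub_integral_prod [IsProbabilityMeasure μ] [IsProbabilityMeasure ν]
    {g : α × β → ℝ} (hg : Measurable g) {a b : ℝ≥0}
    (ha : ∀ x x' y, |g (x, y) - g (x', y)| ≤ a)
    (hb : ∀ x, HasSubgaussianMGF (fun y => g (x, y) - ∫ y', g (x, y') ∂ν) b ν) :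
    HasSubgaussianMGF (fun z => g z - ∫ z', g z' ∂μ.prod ν) ((a / 2) ^ 2 + b) (μ.prod ν) := by
  let G (x : α) : ℝ := ∫ y, g (x, y) ∂ν
  have hG : Measurable G := hg.stronglyMeasurable.integral_prod_right'.measurable
  have hsection (x : α) : Integrable (fun y => g (x, y)) ν :=
    ((hb x).integrable.add (integrable_const (G x))).congr
      (.of_forall fun y => sub_add_cancel _ _)
  have hGosc (x x' : α) : |G x - G x'| ≤ a := by
    rw [← integral_sub (hsection x) (hsection x')]
    have h := norm_integral_le_of_norm_le_const (μ := ν) (f := fun y => g (x, y) - g (x', y))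
      (.of_forall (ha x x'))
    rwa [probReal_univ, mul_one] at h
  have hsum := hasSubgaussianMGF_add_prod
    (hasSubgaussianMGF_sub_integral_of_abs_sub_le (μ := μ) hG.aemeasurable hGosc)
    (hg.sub (hG.comp measurable_fst)) hb
  have hmean : ∫ x, G x ∂μ = ∫ z, g z ∂μ.prod ν := by
    refine (integral_prod g ?_).symm
    refine (hsum.integrable.add (integrable_const (∫ x, G x ∂μ))).congr (.of_forall fun z => ?_)
    simp only [Pi.add_apply, Pi.sub_apply, Function.comp_apply]
    ring
  refine hsum.congr (.of_forall fun z => ?_)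
  simp only [Pi.sub_apply, Function.comp_apply, hmean]
  ring

/-- Changing the `j`-th coordinate of the argument changes the value of `f` by at most `c j`. -/
def HasBoundedDifferences {ι : Type*} {E : ι → Type*} (f : (∀ i, E i) → ℝ) (c : ι → ℝ≥0) : Prop :=
  ∀ ⦃j : ι⦄ ⦃x y : ∀ i, E i⦄, (∀ i, i ≠ j → x i = y i) → |f x - f y| ≤ c j

/-- **McDiarmid's inequality** in its sub-Gaussian form. -/
theorem HasBoundedDifferences.hasSubgaussianMGF {n : ℕ} {E : Fin n → Type*}
    [∀ i, MeasurableSpace (E i)] {P : ∀ i, Measure (E i)} [∀ i, IsProbabilityMeasure (P i)]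
    {f : (∀ i, E i) → ℝ} {c : Fin n → ℝ≥0} (hc : HasBoundedDifferences f c) (hf : Measurable f) :
    HasSubgaussianMGF (fun x => f x - ∫ y, f y ∂Measure.pi P) (∑ i, (c i / 2) ^ 2)
      (Measure.pi P) := by
  induction n with
  | zero =>
    have hconst : f = fun _ => f default := funext fun x => congrArg f (Subsingleton.elim x _)
    rw [hconst]
    simp
  | succ n ih =>
    let e := MeasurableEquiv.piFinSuccAbove E 0
    have he : MeasurePreserving e (Measure.pi P)
        ((P 0).prod (Measure.pi fun j => P (Fin.succAbove 0 j))) :=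
      measurePreserving_piFinSuccAbove P 0
    have hsymm₀ (z) : e.symm z 0 = z.1 := Fin.insertNth_apply_same (α := E) 0 z.1 z.2
    have hsymm (z) (j : Fin n) : e.symm z (Fin.succAbove 0 j) = z.2 j :=
      Fin.insertNth_apply_succAbove 0 z.1 z.2 j
    let g (z : E 0 × ∀ j, E (Fin.succAbove 0 j)) : ℝ := f (e.symm z)
    have hg : Measurable g := hf.comp e.symm.measurable
    have hge (x : ∀ i, E i) : g (e x) = f x := congrArg f (e.symm_apply_apply x)
    have hfirst (x x' : E 0) (y) : |g (x, y) - g (x', y)| ≤ c 0 := hc fun i hi => by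
      obtain ⟨j, rfl⟩ := Fin.exists_succAbove_eq hi
      rw [hsymm, hsymm]
    have hrest (x : E 0) :
        HasBoundedDifferences (fun y => g (x, y)) fun j => c (Fin.succAbove 0 j) :=
      fun j y y' hy => hc fun i hi => by
        rcases eq_or_ne i 0 with rfl | hi₀
        · rw [hsymm₀, hsymm₀]
        · obtain ⟨i, rfl⟩ := Fin.exists_succAbove_eq hi₀
          rw [hsymm, hsymm]
          exact hy i fun hij => hi (congrArg _ hij)
    have hprod := hasSubgaussianMGF_sub_integral_prod (μ := P 0) hg hfirst
      fun x => ih (P := fun j => P (Fin.succAbove 0 j)) (hrest x) (hg.comp measurable_prodMk_left)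
    have hmean : ∫ x, f x ∂Measure.pi P
        = ∫ z, g z ∂(P 0).prod (Measure.pi fun j => P (Fin.succAbove 0 j)) :=
      (integral_congr_ae (.of_forall fun x => (hge x).symm)).trans (he.integral_comp' g)
    rw [Fin.sum_univ_succAbove _ 0, hmean]
    rw [← he.map_eq] at hprod ⊢
    exact (hprod.of_map he.measurable.aemeasurable).congr
      (.of_forall fun x => by simp only [Function.comp_apply, hge])

lemma one_sub_le_measureReal_of_hasSubgaussianMGF [IsProbabilityMeasure μ] {X : α → ℝ}
    {c : ℝ≥0} (hX : HasSubgaussianMGF X c μ) {δ : ℝ} (hδ : 0 < δ) (hδ1 : δ ≤ 1) :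
    1 - δ ≤ μ.real {x | X x ≤ √(2 * c * Real.log (1 / δ))} := by
  set q := √(2 * c * Real.log (1 / δ)) with hq
  suffices htail : μ.real {x | q < X x} ≤ δ by
    have hcover := measureReal_union_le (μ := μ) {x | X x ≤ q} {x | q < X x}
    have huniv : {x | X x ≤ q} ∪ {x | q < X x} = Set.univ :=
      Set.eq_univ_of_forall fun x => le_or_gt (X x) q
    rw [huniv, probReal_univ] at hcover
    linarith
  rcases eq_or_ne c 0 with rfl | hc
  · have hX₀ : ∀ᵐ x ∂μ, X x ≤ q :=
      hX.ae_eq_zero_of_hasSubgaussianMGF_zero.mono fun x hx => hx.trans_le (Real.sqrt_nonneg _)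
    simp only [ae_iff, not_le] at hX₀
    rw [measureReal_def, hX₀, ENNReal.toReal_zero]
    exact hδ.le
  · have hlog : 0 ≤ Real.log (1 / δ) := Real.log_nonneg (by rwa [one_le_div hδ])
    calc μ.real {x | q < X x} ≤ μ.real {x | q ≤ X x} :=
          measureReal_mono (Set.ofPred_subset_ofPred.2 fun _ => le_of_lt)
      _ ≤ Real.exp (-q ^ 2 / (2 * c)) := hX.measure_ge_le (Real.sqrt_nonneg _)
      _ = δ := by
          rw [hq, Real.sq_sqrt (by positivity), neg_div, mul_div_cancel_left₀ _ (by positivity),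
            one_div, Real.log_inv, neg_neg, Real.exp_log hδ]

end BoundedDifferences

/-! ### Symmetrization -/

section Supremum

variable {ι : Type*} [Nonempty ι]

lemma abs_ciSup_le {y : ι → ℝ} {B : ℝ} (h : ∀ i, |y i| ≤ B) : |⨆ i, y i| ≤ B := by
  have hbdd : BddAbove (Set.range y) := ⟨B, Set.forall_mem_range.2 fun i => (abs_le.1 (h i)).2⟩
  refine abs_le.2 ⟨?_, ciSup_le fun i => (abs_le.1 (h i)).2⟩
  exact (abs_le.1 (h (Classical.arbitrary ι))).1.trans (le_ciSup hbdd _)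

lemma ciSup_sub_ciSup_le {y z : ι → ℝ} {c : ℝ} (hz : BddAbove (Set.range z))
    (h : ∀ i, y i - z i ≤ c) : (⨆ i, y i) - ⨆ i, z i ≤ c :=
  sub_le_iff_le_add.2 <| ciSup_le fun i => by linarith [h i, le_ciSup hz i]

lemma integrable_iSup_of_abs_le [Countable ι] {S : Type*} [MeasurableSpace S] {μ : Measure S}
    [IsFiniteMeasure μ] {f : ι → S → ℝ} {B : ℝ} (hf : ∀ i, Measurable (f i))
    (hB : ∀ i t, |f i t| ≤ B) : Integrable (fun t => ⨆ i, f i t) μ :=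
  .of_bound (Measurable.iSup hf).aestronglyMeasurable B
    (.of_forall fun t => abs_ciSup_le fun i => hB i t)

end Supremum

section SignedSums

variable {ι κ : Type*} [Fintype κ]

lemma abs_sum_le_card_mul {v : κ → ℝ} {B : ℝ} (h : ∀ c, |v c| ≤ B) :
    |∑ c, v c| ≤ Fintype.card κ * B := by
  refine (Finset.abs_sum_le_sum_abs _ _).trans ?_
  exact (Finset.sum_le_card_nsmul _ _ _ fun c _ => h c).trans_eq (nsmul_eq_mul _ _)

lemma bddAbove_range_sum_smul {v : ι → κ → ℝ} {B : ℝ} (hv : ∀ i c, |v i c| ≤ B) (ε : κ → ℤˣ) :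
    BddAbove (Set.range fun i => ∑ c, ε c • v i c) :=
  ⟨_, Set.forall_mem_range.2 fun i => (le_abs_self _).trans <|
    abs_sum_le_card_mul fun c => (abs_units_smul (ε c) _).trans_le (hv i c)⟩

variable [DecidableEq κ] {v w : ι → κ → ℝ} {B : ℝ}

lemma rademacherComplexity_reindex_le {ι' : Type*} [Nonempty ι'] (hv : ∀ i c, |v i c| ≤ B)
    (e : ι' → ι) : rademacherComplexity (v ∘ e) ≤ rademacherComplexity v := by
  refine div_le_div_of_nonneg_right (Finset.sum_le_sum fun ε _ => ?_) (by positivity)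
  exact ciSup_le fun i => le_ciSup (bddAbove_range_sum_smul hv ε) (e i)

lemma rademacherComplexity_sub_le [Nonempty ι] (hv : ∀ i c, |v i c| ≤ B)
    (hw : ∀ i c, |w i c| ≤ B) :
    rademacherComplexity (v - w) ≤ rademacherComplexity v + rademacherComplexity w := by
  have hsup (ε : κ → ℤˣ) : ⨆ i, ∑ c, ε c • (v - w) i c
      ≤ (⨆ i, ∑ c, ε c • v i c) + ⨆ i, ∑ c, (-ε) c • w i c := ciSup_le fun i => by
    have hsplit : ∑ c, ε c • (v - w) i c = ∑ c, ε c • v i c + ∑ c, (-ε) c • w i c := by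
      rw [← Finset.sum_add_distrib]
      refine Finset.sum_congr rfl fun c _ => ?_
      rw [Pi.sub_apply, Pi.sub_apply, Pi.neg_apply, Units.neg_smul, smul_sub, sub_eq_add_neg]
    exact hsplit.trans_le <| add_le_add (le_ciSup (bddAbove_range_sum_smul hv ε) i)
      (le_ciSup (bddAbove_range_sum_smul hw (-ε)) i)
  have hneg : ∑ ε : κ → ℤˣ, ⨆ i, ∑ c, (-ε) c • w i c = ∑ ε : κ → ℤˣ, ⨆ i, ∑ c, ε c • w i c :=
    Fintype.sum_equiv (Equiv.neg _) _ _ fun _ => rfl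
  rw [rademacherComplexity, rademacherComplexity, rademacherComplexity, ← add_div, ← hneg,
    ← Finset.sum_add_distrib]
  exact div_le_div_of_nonneg_right (Finset.sum_le_sum fun ε _ => hsup ε) (by positivity)

end SignedSums

section Symmetrization

variable {E ι κ : Type*} [MeasurableSpace E] [Fintype κ] {P : Measure E} [IsProbabilityMeasure P]

/-- The deviation `∑_c (E_P u - u(x_c))` of the sum of `u` over the sample `x` from its
expectation. -/
def deviation (P : Measure E) (u : E → ℝ) (x : κ → E) : ℝ := ∑ c, (∫ e, u e ∂P - u (x c))

omit [IsProbabilityMeasure P] in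
lemma measurable_deviation {u : E → ℝ} (hu : Measurable u) :
    Measurable fun x : κ → E => deviation P u x :=
  Finset.measurable_sum _ fun c _ => (hu.comp (measurable_pi_apply c)).const_sub _

lemma integrable_of_abs_le {u : E → ℝ} (hu : Measurable u) {b : ℝ} (hb : ∀ e, |u e| ≤ b) :
    Integrable u P :=
  .of_bound hu.aestronglyMeasurable b (.of_forall hb)

lemma abs_deviation_le {u : E → ℝ} {b : ℝ} (hb : ∀ e, |u e| ≤ b) (x : κ → E) :
    |deviation P u x| ≤ Fintype.card κ * (b + b) := by
  have hmean : |∫ e, u e ∂P| ≤ b := by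
    simpa using norm_integral_le_of_norm_le_const (μ := P) (f := u) (.of_forall hb)
  exact abs_sum_le_card_mul fun c => (abs_sub _ _).trans (add_le_add hmean (hb _))

omit [IsProbabilityMeasure P] in
lemma deviation_sub {u v : E → ℝ} (hu : Integrable u P) (hv : Integrable v P) (x : κ → E) :
    deviation P (u - v) x = deviation P u x - deviation P v x := by
  rw [deviation, deviation, deviation, ← Finset.sum_sub_distrib, integral_sub' hu hv]
  exact Finset.sum_congr rfl fun c _ => sub_sub_sub_comm _ _ _ _

lemma deviation_eq_integral_pi {u : E → ℝ} (hu : Integrable u P) (x : κ → E) :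
    deviation P u x = ∫ y : κ → E, ∑ c, (u (y c) - u (x c)) ∂Measure.pi fun _ => P := by
  have hcoord (c : κ) : Integrable (fun y : κ → E => u (y c)) (Measure.pi fun _ => P) :=
    integrable_comp_eval hu
  have hdiff (c : κ) : Integrable (fun y : κ → E => u (y c) - u (x c)) (Measure.pi fun _ => P) :=
    (hcoord c).sub (integrable_const _)
  rw [deviation, integral_finsetSum _ fun c _ => hdiff c]
  refine Finset.sum_congr rfl fun c _ => ?_
  rw [integral_sub (hcoord c) (integrable_const _), integral_const, probReal_univ, one_smul,
    integral_comp_eval (μ := fun _ : κ => P) hu.aestronglyMeasurable]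

lemma integral_prod_eq_integral_sign_smul (U : ι → E → ℝ) (ε : κ → ℤˣ) :
    ∫ z : (κ → E) × (κ → E), ⨆ i, ∑ c, (U i (z.2 c) - U i (z.1 c))
        ∂(Measure.pi fun _ => P).prod (Measure.pi fun _ => P)
      = ∫ w : κ → E × E, ⨆ i, ∑ c, ε c • (U i (w c).2 - U i (w c).1)
          ∂Measure.pi fun _ => P.prod P := by
  -- Exchanging `(w c).1` and `(w c).2` wherever `ε c = -1` preserves the law of `w`.
  let swap (c : κ) : E × E ≃ᵐ E × E := if ε c = 1 then .refl _ else .prodComm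
  have hswap (c : κ) : MeasurePreserving (swap c) (P.prod P) (P.prod P) := by
    by_cases hc : ε c = 1
    · simpa only [swap, if_pos hc] using! MeasurePreserving.id _
    · simpa only [swap, if_neg hc] using! Measure.measurePreserving_swap
  have hdiff (i : ι) (c : κ) (z : E × E) :
      U i (swap c z).2 - U i (swap c z).1 = ε c • (U i z.2 - U i z.1) := by
    rcases Int.units_eq_one_or (ε c) with hc | hc
    · simp [swap, hc]
    · rw [hc, Units.neg_smul, one_smul, neg_sub]
      simp [swap, hc, MeasurableEquiv.prodComm]
  have hpi : MeasurePreserving (MeasurableEquiv.piCongrRight swap)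
      (Measure.pi fun _ => P.prod P) (Measure.pi fun _ => P.prod P) :=
    measurePreserving_pi _ _ hswap
  rw [← (measurePreserving_arrowProdEquivProdArrow E E κ (fun _ => P) fun _ => P).integral_comp',
    ← hpi.integral_comp']
  simp only [← hdiff]
  rfl

variable [Countable ι] [Nonempty ι] {U : ι → E → ℝ} {b : ℝ}

lemma integral_iSup_deviation_le_integral_prod (hU : ∀ i, Measurable (U i))
    (hb : ∀ i e, |U i e| ≤ b) :
    ∫ x : κ → E, ⨆ i, deviation P (U i) x ∂Measure.pi (fun _ => P)
      ≤ ∫ z : (κ → E) × (κ → E), ⨆ i, ∑ c, (U i (z.2 c) - U i (z.1 c))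
          ∂(Measure.pi fun _ => P).prod (Measure.pi fun _ => P) := by
  have hmeas (i : ι) : Measurable fun z : (κ → E) × (κ → E) =>
      ∑ c, (U i (z.2 c) - U i (z.1 c)) := by
    have := hU i
    fun_prop
  have hbound (i : ι) (z : (κ → E) × (κ → E)) :
      |∑ c, (U i (z.2 c) - U i (z.1 c))| ≤ Fintype.card κ * (b + b) :=
    abs_sum_le_card_mul fun c => (abs_sub _ _).trans (add_le_add (hb i _) (hb i _))
  have hint := integrable_iSup_of_abs_le
    (μ := (Measure.pi fun _ : κ => P).prod (Measure.pi fun _ => P)) hmeas hbound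
  rw [integral_prod _ hint]
  refine integral_mono (integrable_iSup_of_abs_le (fun i => measurable_deviation (hU i))
    fun i => abs_deviation_le (hb i)) hint.integral_prod_left fun x => ciSup_le fun i => ?_
  rw [deviation_eq_integral_pi (integrable_of_abs_le (hU i) (hb i))]
  have hmeas_x (i : ι) := (hmeas i).comp (measurable_prodMk_left (x := x))
  refine integral_mono (integrable_of_abs_le (hmeas_x i) fun y => hbound i (x, y))
    (integrable_iSup_of_abs_le hmeas_x fun i y => hbound i (x, y)) fun y => ?_
  exact le_ciSup (f := fun i => ∑ c, (U i (y c) - U i (x c)))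
    ⟨_, Set.forall_mem_range.2 fun i => (le_abs_self _).trans (hbound i (x, y))⟩ i

lemma integral_iSup_deviation_le [DecidableEq κ] (hU : ∀ i, Measurable (U i))
    (hb : ∀ i e, |U i e| ≤ b) {K : ℝ}
    (hK : ∀ x : κ → E, rademacherComplexity (fun i c => U i (x c)) ≤ K) :
    ∫ x : κ → E, ⨆ i, deviation P (U i) x ∂Measure.pi (fun _ => P) ≤ 2 * K := by
  refine (integral_iSup_deviation_le_integral_prod hU hb).trans ?_
  have hmeas (ε : κ → ℤˣ) (i : ι) : Measurable fun w : κ → E × E =>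
      ∑ c, ε c • (U i (w c).2 - U i (w c).1) := by
    have := hU i
    fun_prop
  have hbound (ε : κ → ℤˣ) (i : ι) (w : κ → E × E) :
      |∑ c, ε c • (U i (w c).2 - U i (w c).1)| ≤ Fintype.card κ * (b + b) :=
    abs_sum_le_card_mul fun c => (abs_units_smul _ _).trans_le <|
      (abs_sub _ _).trans (add_le_add (hb i _) (hb i _))
  have hint (ε : κ → ℤˣ) := integrable_iSup_of_abs_le (μ := Measure.pi fun _ : κ => P.prod P)
    (hmeas ε) (hbound ε)
  have hrad (w : κ → E × E) :
      ∑ ε : κ → ℤˣ, ⨆ i, ∑ c, ε c • (U i (w c).2 - U i (w c).1)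
        ≤ 2 ^ Fintype.card κ * (2 * K) := by
    have hsub := rademacherComplexity_sub_le (fun i c => hb i (w c).2) (fun i c => hb i (w c).1)
    refine (div_le_iff₀' (by positivity)).1 (hsub.trans ?_)
    linarith [hK fun c => (w c).1, hK fun c => (w c).2]
  have havg := integral_mono (integrable_finsetSum _ fun ε _ => hint ε)
    (integrable_const (2 ^ Fintype.card κ * (2 * K))) hrad
  rw [integral_finsetSum _ fun ε _ => hint ε, integral_const, probReal_univ, one_smul] at havg
  simp only [← integral_prod_eq_integral_sign_smul (P := P) U, Finset.sum_const,
    Finset.card_univ, nsmul_eq_mul] at havg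
  refine le_of_mul_le_mul_left ?_ (pow_pos two_pos (Fintype.card κ))
  simpa using havg

end Symmetrization

/-! ### Uniform deviations -/

section UniformDeviation

variable {E ι : Type*} [MeasurableSpace E] [Countable ι] [Nonempty ι] {P : Measure E}
  [IsProbabilityMeasure P] {n : ℕ} {U : ι → E → ℝ} {b : ℝ≥0} {K δ : ℝ}

omit [Countable ι] in
lemma hasBoundedDifferences_iSup_deviation (hb : ∀ i e, |U i e| ≤ b) :
    HasBoundedDifferences (fun x : Fin n → E => ⨆ i, deviation P (U i) x) fun _ => b + b := by
  intro j x y hxy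
  have hdiff (i : ι) : |deviation P (U i) x - deviation P (U i) y| ≤ b + b := by
    have hsum : deviation P (U i) x - deviation P (U i) y = U i (y j) - U i (x j) := by
      rw [deviation, deviation, ← Finset.sum_sub_distrib,
        Finset.sum_eq_single_of_mem j (Finset.mem_univ j) fun c _ hc => by rw [hxy c hc, sub_self]]
      ring
    rw [hsum]
    exact (abs_sub _ _).trans (add_le_add (hb i _) (hb i _))
  have hbdd (x : Fin n → E) : BddAbove (Set.range fun i => deviation P (U i) x) :=
    ⟨_, Set.forall_mem_range.2 fun i => (le_abs_self _).trans (abs_deviation_le (hb i) x)⟩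
  rw [NNReal.coe_add]
  refine abs_sub_le_iff.2 ⟨ciSup_sub_ciSup_le (hbdd y) fun i => (abs_sub_le_iff.1 (hdiff i)).1,
    ciSup_sub_ciSup_le (hbdd x) fun i => (abs_sub_le_iff.1 (hdiff i)).2⟩

lemma one_sub_le_measureReal_deviation_le (hU : ∀ i, Measurable (U i))
    (hb : ∀ i e, |U i e| ≤ b)
    (hK : ∀ x : Fin n → E, rademacherComplexity (fun i c => U i (x c)) ≤ K)
    (hδ : 0 < δ) (hδ1 : δ ≤ 1) :
    1 - δ ≤ (Measure.pi fun _ : Fin n => P).real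
      {x | ∀ i, deviation P (U i) x ≤ 2 * K + b * √(2 * n * Real.log (1 / δ))} := by
  have hmcd := (hasBoundedDifferences_iSup_deviation (P := P) hb).hasSubgaussianMGF
    (P := fun _ : Fin n => P) (Measurable.iSup fun i => measurable_deviation (hU i))
  refine (one_sub_le_measureReal_of_hasSubgaussianMGF hmcd hδ hδ1).trans
    (measureReal_mono fun x hx i => ?_)
  have hquantile : √(2 * ((∑ _ : Fin n, ((b + b) / 2) ^ 2 : ℝ≥0) : ℝ) * Real.log (1 / δ))
      = b * √(2 * n * Real.log (1 / δ)) := by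
    rw [add_self_div_two, Finset.sum_const, Finset.card_fin, nsmul_eq_mul, NNReal.coe_mul,
      NNReal.coe_natCast, NNReal.coe_pow,
      show 2 * (n * (b : ℝ) ^ 2) * Real.log (1 / δ) = b ^ 2 * (2 * n * Real.log (1 / δ)) by ring,
      Real.sqrt_mul (sq_nonneg _), Real.sqrt_sq b.coe_nonneg]
  have hsup := le_ciSup (f := fun i => deviation P (U i) x)
    ⟨_, Set.forall_mem_range.2 fun i => (le_abs_self _).trans (abs_deviation_le (hb i) x)⟩ i
  have hx : (⨆ i, deviation P (U i) x)
      - ∫ y : Fin n → E, ⨆ i, deviation P (U i) y ∂Measure.pi (fun _ => P)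
      ≤ √(2 * ((∑ _ : Fin n, ((b + b) / 2) ^ 2 : ℝ≥0) : ℝ) * Real.log (1 / δ)) := hx
  rw [hquantile] at hx
  linarith [integral_iSup_deviation_le (P := P) hU hb hK]

lemma one_sub_le_measureReal_deviation_sub_le (hU : ∀ i, Measurable (U i))
    (hb : ∀ i e, |U i e| ≤ b)
    (hK : ∀ x : Fin n → E, rademacherComplexity (fun i c => U i (x c)) ≤ K)
    (hδ : 0 < δ) (hδ1 : δ ≤ 1) :
    1 - δ ≤ (Measure.pi fun _ : Fin n => P).real
      {x | ∀ i j, deviation P (U i) x - deviation P (U j) x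
        ≤ 4 * K + 2 * b * √(2 * n * Real.log (1 / δ))} := by
  have hbdiff (p : ι × ι) (e : E) : |(U p.1 - U p.2) e| ≤ (b + b : ℝ≥0) :=
    (abs_sub _ _).trans (add_le_add (hb p.1 e) (hb p.2 e))
  have hKdiff (x : Fin n → E) :
      rademacherComplexity (fun (p : ι × ι) c => (U p.1 - U p.2) (x c)) ≤ K + K :=
    calc rademacherComplexity (fun (p : ι × ι) c => (U p.1 - U p.2) (x c))
        ≤ rademacherComplexity (fun (p : ι × ι) c => U p.1 (x c))
          + rademacherComplexity (fun (p : ι × ι) c => U p.2 (x c)) :=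
          rademacherComplexity_sub_le (fun p c => hb p.1 (x c)) fun p c => hb p.2 (x c)
      _ ≤ K + K := add_le_add
          ((rademacherComplexity_reindex_le (fun i c => hb i (x c)) Prod.fst).trans (hK x))
          ((rademacherComplexity_reindex_le (fun i c => hb i (x c)) Prod.snd).trans (hK x))
  refine (one_sub_le_measureReal_deviation_le (P := P) (fun p : ι × ι => (hU p.1).sub (hU p.2))
    hbdiff hKdiff hδ hδ1).trans (measureReal_mono fun x hx i j => ?_)
  have hij : deviation P (U i - U j) x
    ≤ 2 * (K + K) + (b + b : ℝ≥0) * √(2 * n * Real.log (1 / δ)) := hx (i, j)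
  rw [deviation_sub (integrable_of_abs_le (hU i) (hb i)) (integrable_of_abs_le (hU j) (hb j)),
    NNReal.coe_add] at hij
  linarith

end UniformDeviation

section Restriction

variable {E ι κ : Type*} [MeasurableSpace E] [Fintype κ] {P : Measure E} {E₀ : Set E}

lemma deviation_congr_of_mem {u v : E → ℝ} (hP : ∀ᵐ e ∂P, e ∈ E₀) (huv : Set.EqOn u v E₀)
    {x : κ → E} (hx : ∀ c, x c ∈ E₀) : deviation P u x = deviation P v x := by
  rw [deviation, deviation, integral_congr_ae (hP.mono fun e he => huv he)]
  exact Finset.sum_congr rfl fun c _ => by rw [huv (hx c)]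

lemma deviation_sub_const [IsProbabilityMeasure P] {u : E → ℝ} (hu : Integrable u P) (a : ℝ)
    (x : κ → E) : deviation P (fun e => u e - a) x = deviation P u x := by
  rw [deviation, deviation, integral_sub hu (integrable_const a), integral_const, probReal_univ,
    one_smul]
  exact Finset.sum_congr rfl fun c _ => sub_sub_sub_cancel_right _ _ _

lemma continuous_deviation [IsFiniteMeasure P] {T : Type*} [TopologicalSpace T]
    [FirstCountableTopology T] {u : T → E → ℝ} {b : ℝ} (hu : ∀ t, Measurable (u t))
    (hcont : ∀ e ∈ E₀, Continuous fun t => u t e) (hb : ∀ t, ∀ e ∈ E₀, |u t e| ≤ b)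
    (hP : ∀ᵐ e ∂P, e ∈ E₀) {x : κ → E} (hx : ∀ c, x c ∈ E₀) :
    Continuous fun t => deviation P (u t) x := by
  have hmean : Continuous fun t => ∫ e, u t e ∂P :=
    continuous_of_dominated (fun t => (hu t).aestronglyMeasurable)
      (fun t => hP.mono fun e he => hb t e he) (integrable_const b) (hP.mono hcont)
  exact continuous_finsetSum _ fun c _ => hmean.sub (hcont _ (hx c))

lemma one_sub_le_measureReal_mem_and_deviation_sub_le [IsProbabilityMeasure P] [Countable ι]
    [Nonempty ι] {n : ℕ} {U : ι → E → ℝ} {b : ℝ≥0} {K δ : ℝ} (hU : ∀ i, Measurable (U i))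
    (hE : MeasurableSet E₀) (hP : ∀ᵐ e ∂P, e ∈ E₀) (hb : ∀ i, ∀ e ∈ E₀, |U i e| ≤ b)
    (hK : ∀ x : Fin n → E, (∀ c, x c ∈ E₀) → rademacherComplexity (fun i c => U i (x c)) ≤ K)
    (hδ : 0 < δ) (hδ1 : δ ≤ 1) :
    1 - δ ≤ (Measure.pi fun _ : Fin n => P).real
      {x | (∀ c, x c ∈ E₀) ∧ ∀ i j, deviation P (U i) x - deviation P (U j) x
        ≤ 4 * K + 2 * b * √(2 * n * Real.log (1 / δ))} := by
  classical
  obtain ⟨e₀, he₀⟩ := hP.exists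
  -- Outside `E₀` the functions are unconstrained, so they are replaced by their value at `e₀`.
  let ρ : E → E := fun e => if e ∈ E₀ then e else e₀
  have hρ_mem (e : E) : ρ e ∈ E₀ := by
    by_cases he : e ∈ E₀
    · simpa only [ρ, if_pos he] using he
    · simpa only [ρ, if_neg he] using he₀
  have hρ_eqOn (u : E → ℝ) : Set.EqOn u (u ∘ ρ) E₀ := fun e he => by
    simp only [ρ, Function.comp_apply, if_pos he]
  have hρ : Measurable ρ := measurable_id.ite hE measurable_const
  refine (one_sub_le_measureReal_deviation_sub_le (P := P) (fun i => (hU i).comp hρ)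
    (fun i e => hb i _ (hρ_mem e)) (fun x => hK (ρ ∘ x) fun c => hρ_mem _) hδ hδ1).trans
    (ENNReal.toReal_mono (measure_ne_top _ _) (measure_mono_ae ?_))
  have hsample : ∀ᵐ x ∂Measure.pi fun _ : Fin n => P, ∀ c, x c ∈ E₀ := ae_all_iff.2 fun c =>
    (measurePreserving_eval (fun _ : Fin n => P) c).quasiMeasurePreserving.ae hP
  filter_upwards [hsample] with x hx hdev
  refine ⟨hx, fun i j => ?_⟩
  rw [deviation_congr_of_mem hP (hρ_eqOn (U i)) hx, deviation_congr_of_mem hP (hρ_eqOn (U j)) hx]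
  exact hdev i j

end Restriction

section Samples

lemma exists_measurableSet_subset_preimage {S F : Type*} [MeasurableSpace S] [MeasurableSpace F]
    {μ : Measure S} {ν : Measure F} {Y : S → F} (hY : HasLaw Y ν μ) {M : Set F}
    (hM : MeasurableSet M) : ∃ A ⊆ Y ⁻¹' M, MeasurableSet A ∧ μ.real A = ν.real M := by
  obtain ⟨A, hAM, hA, hAae⟩ :=
    (hY.aemeasurable.nullMeasurableSet_preimage hM).exists_measurable_subset_ae_eq
  refine ⟨A, hAM, hA, ?_⟩
  rw [measureReal_congr hAae, ← hY.map_eq, measureReal_def, measureReal_def,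
    Measure.map_apply_of_aemeasurable hY.aemeasurable hM]

variable {E S : Type*} [MeasurableSpace E] [MeasurableSpace S] {n : ℕ}

lemma integral_empirical [MeasurableSingletonClass E] (x : Fin n → E) (u : E → ℝ) :
    ∫ e, u e ∂empirical x = (n : ℝ)⁻¹ * ∑ c, u (x c) := by
  rw [empirical, integral_smul_measure,
    integral_finsetSum_measure fun c _ => integrable_dirac (by simp)]
  simp [integral_dirac]

lemma integral_sub_integral_empirical_eq_deviation_div [MeasurableSingletonClass E] (hn : 0 < n)
    (P : Measure E) (u : E → ℝ) (x : Fin n → E) :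
    ∫ e, u e ∂P - ∫ e, u e ∂empirical x = deviation P u x / n := by
  have hn0 : (n : ℝ) ≠ 0 := by positivity
  rw [integral_empirical, deviation, Finset.sum_sub_distrib, Finset.sum_const, Finset.card_fin,
    nsmul_eq_mul]
  field_simp

/-- With probability at least `1 - δ` over the sample `X`, the errors `E_P u_t - E_{P̂} u_t` made by
replacing `P` by the empirical distribution of `X` differ by at most `β` from one `t` to another. -/
def UniformDeviationBound {T : Type*} (u : T → E → ℝ) (P : Measure E) (μ : Measure S)
    (X : Fin n → S → E) (δ β : ℝ) : Prop :=
  ∃ A : Set S, MeasurableSet A ∧ 1 - δ ≤ μ.real A ∧ ∀ ξ ∈ A, ∀ t t',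
    (∫ e, u t e ∂P - ∫ e, u t e ∂empirical fun i => X i ξ)
      - (∫ e, u t' e ∂P - ∫ e, u t' e ∂empirical fun i => X i ξ) ≤ β

variable {T : Type*} [TopologicalSpace T] [FirstCountableTopology T]
  [TopologicalSpace.SeparableSpace T] [Nonempty T] {P : Measure E} [IsProbabilityMeasure P]
  {μ : Measure S} {X : Fin n → S → E} {δ : ℝ}

lemma uniformDeviationBound_of_rademacherComplexity_le [MeasurableSingletonClass E]
    (hX : ∀ i, HasLaw (X i) P μ) (hind : iIndepFun X μ) (hn : 0 < n) (hδ : 0 < δ) (hδ1 : δ ≤ 1)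
    {E₀ : Set E} (hE : MeasurableSet E₀) (hP : ∀ᵐ e ∂P, e ∈ E₀) {u : T → E → ℝ} {b : ℝ≥0} {K : ℝ}
    (hu : ∀ t, Measurable (u t)) (hcont : ∀ e ∈ E₀, Continuous fun t => u t e)
    (hb : ∀ t, ∀ e ∈ E₀, |u t e| ≤ b)
    (hK : ∀ x : Fin n → E, (∀ c, x c ∈ E₀) → rademacherComplexity (fun t c => u t (x c)) ≤ K) :
    UniformDeviationBound u P μ X δ ((4 * K + 2 * b * √(2 * n * Real.log (1 / δ))) / n) := by
  obtain ⟨s, hs, hsd⟩ := TopologicalSpace.exists_countable_dense T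
  have := hs.to_subtype
  have := hsd.nonempty.to_subtype
  set β := 4 * K + 2 * b * √(2 * n * Real.log (1 / δ))
  let M : Set (Fin n → E) :=
    {x | (∀ c, x c ∈ E₀) ∧ ∀ i j : s, deviation P (u i) x - deviation P (u j) x ≤ β}
  have hM : MeasurableSet M := by
    simp only [M, Set.ofPred_and, Set.ofPred_forall]
    exact .inter (.iInter fun c => measurable_pi_apply c hE) <| .iInter fun i => .iInter fun j =>
      measurableSet_le ((measurable_deviation (hu i)).sub (measurable_deviation (hu j)))
        measurable_const
  have hprob : 1 - δ ≤ (Measure.pi fun _ : Fin n => P).real M :=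
    one_sub_le_measureReal_mem_and_deviation_sub_le (fun i : s => hu i) hE hP
      (fun i : s => hb i) (fun x hx => (rademacherComplexity_reindex_le
        (fun t c => hb t _ (hx c)) ((↑) : s → T)).trans (hK x hx)) hδ hδ1
  obtain ⟨A, hAM, hA, hAprob⟩ := exists_measurableSet_subset_preimage (hind.hasLaw_pi hX) hM
  refine ⟨A, hA, hprob.trans_eq hAprob.symm, fun ξ hξ t t' => ?_⟩
  obtain ⟨hx, hdev⟩ : (fun i => X i ξ) ∈ M := hAM hξ
  have hdev_cont := continuous_deviation hu hcont hb hP hx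
  have hdense : ∀ t t', deviation P (u t) (X · ξ) - deviation P (u t') (X · ξ) ≤ β :=
    isClosed_property2 hsd.denseRange_val
      (isClosed_le ((hdev_cont.comp continuous_fst).sub (hdev_cont.comp continuous_snd))
        continuous_const) hdev
  rw [integral_sub_integral_empirical_eq_deviation_div hn,
    integral_sub_integral_empirical_eq_deviation_div hn, ← sub_div]
  exact div_le_div_of_nonneg_right (hdense t t') (Nat.cast_nonneg n)

omit [TopologicalSpace T] [FirstCountableTopology T] [TopologicalSpace.SeparableSpace T]
  [Nonempty T] in
lemma UniformDeviationBound.of_sub_const [MeasurableSingletonClass E] {u : T → E → ℝ} {a β : ℝ}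
    (hn : 0 < n) (hu : ∀ t, Integrable (u t) P)
    (h : UniformDeviationBound (fun t e => u t e - a) P μ X δ β) :
    UniformDeviationBound u P μ X δ β := by
  simpa only [UniformDeviationBound, integral_sub_integral_empirical_eq_deviation_div hn,
    deviation_sub_const (hu _)] using h

end Samples

lemma rademacher_mcdiarmid_bound_div_eq (n : ℕ) (q s L : ℝ) :
    (4 * (q * √n * s) + 2 * q * √(2 * n * L)) / n = 4 * q * s / √n + 2 * √(2 * L) * (q / √n) := by
  rw [show 2 * n * L = n * (2 * L) by ring, Real.sqrt_mul (Nat.cast_nonneg n),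
    show 4 * (q * √n * s) + 2 * q * (√n * √(2 * L)) = √n * (4 * q * s + 2 * √(2 * L) * q) by ring,
    mul_div_right_comm, Real.sqrt_div_self', one_div, inv_mul_eq_div, add_div, mul_div_assoc _ q]

lemma HasExpMomentBound.abs_comp_sub_le {T H : Type*} [NormedAddCommGroup H] {f : T → H → ℝ}
    {A B : ℝ} {K : ℕ} {C : ℝ≥0} {h : ℝ → ℝ} (hf : HasExpMomentBound f A K) (hA : 0 ≤ A)
    (hLip : LipschitzOnWith C h (Metric.closedBall 0 (A * B))) (t : T) {x : H} (hx : ‖x‖ ≤ B) :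
    |h (f t x) - h 0| ≤ C * (A * B) := by
  have hmem := hf.apply_mem_closedBall hA t hx
  have hB : 0 ≤ B := (norm_nonneg x).trans hx
  refine (hLip.dist_le_mul _ hmem 0 (Metric.mem_closedBall_self (by positivity))).trans ?_
  gcongr
  exact hmem

section Lipschitz

variable {T H S : Type*} [TopologicalSpace T] [FirstCountableTopology T]
  [TopologicalSpace.SeparableSpace T] [Nonempty T] [NormedAddCommGroup H] [InnerProductSpace ℝ H]
  [MeasurableSpace H] [BorelSpace H] {P : Measure H} [IsProbabilityMeasure P] [MeasurableSpace S]
  {μ : Measure S} {n : ℕ} {X : Fin n → S → H} {δ : ℝ}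

lemma HasExpMomentBound.uniformDeviationBound {f : T → H → ℝ} {A B : ℝ} {K : ℕ} {C : ℝ≥0}
    {h : ℝ → ℝ} (hf : HasExpMomentBound f A K) (hX : ∀ i, HasLaw (X i) P μ)
    (hind : iIndepFun X μ) (hn : 0 < n) (hδ : 0 < δ) (hδ1 : δ ≤ 1) (hA : 0 ≤ A)
    (hB : ∀ᵐ x ∂P, ‖x‖ ≤ B) (hfx : ∀ t, Continuous (f t)) (hft : ∀ x, Continuous fun t => f t x)
    (hh : Continuous h) (hLip : LipschitzOnWith C h (Metric.closedBall 0 (A * B))) :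
    UniformDeviationBound (fun t x => h (f t x)) P μ X δ
      (4 * (C * (A * B)) * √(3 * (K + 1)) / √n
        + 2 * √(2 * Real.log (1 / δ)) * (C * (A * B) / √n)) := by
  have hB0 : 0 ≤ B := hB.exists.elim fun x hx => (norm_nonneg x).trans hx
  lift C * (A * B) to ℝ≥0 using (by positivity) with b hb
  have hcentered (t : T) {x : H} (hx : ‖x‖ ≤ B) : |h (f t x) - h 0| ≤ b :=
    (hf.abs_comp_sub_le hA hLip t hx).trans_eq hb.symm
  have hcont (t : T) : Continuous fun x => h (f t x) - h 0 := (hh.comp (hfx t)).sub continuous_const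
  have hintegrable (t : T) : Integrable (fun x => h (f t x)) P := by
    have hcentered_int : Integrable (fun x => h (f t x) - h 0) P :=
      .of_bound (hcont t).aestronglyMeasurable b (hB.mono fun x => hcentered t)
    simpa only [Pi.add_def, sub_add_cancel] using hcentered_int.add (integrable_const (h 0))
  have hLip0 : LipschitzOnWith C (fun y => h y - h 0) (Metric.closedBall 0 (A * B)) :=
    fun y hy z hz => by simpa only [edist_sub_right] using hLip hy hz
  have hrad (x : Fin n → H) (hx : ∀ c, ‖x c‖ ≤ B) :
      rademacherComplexity (fun t c => h (f t (x c)) - h 0) ≤ b * √n * √(3 * (K + 1)) := by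
    rw [hb]
    exact hf.rademacherComplexity_comp_le (h := fun y => h y - h 0) hA hB0 (sub_self _) hLip0 hx
  have hbound := uniformDeviationBound_of_rademacherComplexity_le hX hind hn hδ hδ1
    (E₀ := {x | ‖x‖ ≤ B}) (u := fun t x => h (f t x) - h 0)
    (measurableSet_le measurable_norm measurable_const) hB (fun t => (hcont t).measurable)
    (fun x _ => (hh.comp (hft x)).sub continuous_const) (fun t x hx => hcentered t hx) hrad
  rw [rademacher_mcdiarmid_bound_div_eq] at hbound
  exact hbound.of_sub_const hn hintegrable

end Lipschitz

/-! ### From uniform deviations to the estimation error -/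

section EstimationError

lemma ciSup_sub_ciSup_le_of_deviation {Ω Θ : Type*} [Nonempty Ω] {J Ĵ : Θ → Ω → ℝ} {β : ℝ}
    (hJ : ∀ θ, BddAbove (Set.range (J θ)))
    (hdev : ∀ θ ω θ' ω', (J θ ω - Ĵ θ ω) - (J θ' ω' - Ĵ θ' ω') ≤ β) {θ₀ θ : Θ}
    (hmin : ⨆ ω, Ĵ θ₀ ω ≤ ⨆ ω, Ĵ θ ω) : (⨆ ω, J θ₀ ω) - ⨆ ω, J θ ω ≤ β := by
  have hĴ : BddAbove (Set.range (Ĵ θ₀)) := by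
    obtain ⟨ω₀⟩ := ‹Nonempty Ω›
    obtain ⟨D, hD⟩ := hJ θ₀
    refine ⟨β + D - (J θ₀ ω₀ - Ĵ θ₀ ω₀), Set.forall_mem_range.2 fun ω => ?_⟩
    linarith [hdev θ₀ ω₀ θ₀ ω, hD (Set.mem_range_self ω)]
  have hpoint (ω ω' : Ω) : Ĵ θ ω' ≤ β + (⨆ ω, Ĵ θ₀ ω) + (⨆ ω, J θ ω) - J θ₀ ω := by
    linarith [hdev θ₀ ω θ ω', le_ciSup hĴ ω, le_ciSup (hJ θ) ω']
  have hsup (ω : Ω) : J θ₀ ω ≤ β + ⨆ ω, J θ ω := by linarith [ciSup_le (hpoint ω)]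
  exact sub_le_iff_le_add.2 (ciSup_le hsup)

variable {E F ΩD ΘG S : Type*} [MeasurableSpace E] [MeasurableSpace F] [MeasurableSpace S]

lemma one_sub_two_mul_le_measureReal_inter {μ : Measure S} [IsProbabilityMeasure μ] {A B : Set S}
    {δ : ℝ} (hAm : MeasurableSet A) (hBm : MeasurableSet B) (hA : 1 - δ ≤ μ.real A)
    (hB : 1 - δ ≤ μ.real B) : 1 - 2 * δ ≤ μ.real (A ∩ B) := by
  have hunion := measureReal_union_le (μ := μ) Aᶜ Bᶜ
  rw [← Set.compl_inter, probReal_compl_eq_one_sub hAm, probReal_compl_eq_one_sub hBm,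
    probReal_compl_eq_one_sub (hAm.inter hBm)] at hunion
  linarith

lemma estimationErrorBound_of_uniformDeviationBound [MeasurableSingletonClass E]
    [MeasurableSingletonClass F] {ℓ : CPELoss} {D : ΩD → E → ℝ} {Ω : Set ΩD} {g : ΘG → F → E}
    {Θ : Set ΘG} {Pr : Measure E} {PZ : Measure F} {μ : Measure S} [IsProbabilityMeasure μ]
    {n m : ℕ} {X : Fin n → S → E} {Z : Fin m → S → F} {δ β₁ β₂ : ℝ} (hΩ : Ω.Nonempty)
    (hg : ∀ θ, Measurable (g θ)) (hψ : ∀ ω, Measurable fun x => -ℓ 0 (D ω x))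
    (hbdd : ∀ θ : Θ, BddAbove (Set.range fun ω : Ω =>
      (∫ x, -ℓ 1 (D ω x) ∂Pr) + ∫ z, -ℓ 0 (D ω (g θ z)) ∂PZ))
    (h₁ : UniformDeviationBound (fun (ω : Ω) x => -ℓ 1 (D ω x)) Pr μ X δ β₁)
    (h₂ : UniformDeviationBound (fun (t : Ω × Θ) z => -ℓ 0 (D t.1 (g t.2 z))) PZ μ Z δ β₂) :
    EstimationErrorBound ℓ D Ω g Θ Pr PZ μ X Z δ (β₁ + β₂) := by
  obtain ⟨A, hAm, hA, hdev₁⟩ := h₁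
  obtain ⟨B, hBm, hB, hdev₂⟩ := h₂
  have := hΩ.to_subtype
  refine ⟨A ∩ B, hAm.inter hBm, one_sub_two_mul_le_measureReal_inter hAm hBm hA hB,
    fun ξ hξ θ₀ hθ₀ hmin => ?_⟩
  have : Nonempty Θ := ⟨⟨θ₀, hθ₀⟩⟩
  have hempirical (θ : Θ) (ω : Ω) : ∫ x, -ℓ 0 (D ω x) ∂empirical (fun j => g θ (Z j ξ))
      = ∫ z, -ℓ 0 (D ω (g θ z)) ∂empirical fun j => Z j ξ := by
    rw [integral_empirical, integral_empirical]
  have hmap (θ : Θ) (ω : Ω) :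
      ∫ x, -ℓ 0 (D ω x) ∂PZ.map (g θ) = ∫ z, -ℓ 0 (D ω (g θ z)) ∂PZ :=
    integral_map (hg θ).aemeasurable (hψ ω).aestronglyMeasurable
  rw [sub_le_comm]
  refine le_ciInf fun θ => ?_
  have hminθ : lossDiv ℓ D Ω (empirical fun i => X i ξ) (empirical fun j => g θ₀ (Z j ξ))
    ≤ lossDiv ℓ D Ω (empirical fun i => X i ξ) (empirical fun j => g θ (Z j ξ)) := hmin θ.2
  simp only [lossDiv, hempirical θ, hempirical ⟨θ₀, hθ₀⟩, sub_le_sub_iff_right] at hminθ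
  rw [sub_le_comm]
  simp only [lossDiv, hmap θ, hmap ⟨θ₀, hθ₀⟩, sub_sub_sub_cancel_right]
  refine ciSup_sub_ciSup_le_of_deviation (θ₀ := ⟨θ₀, hθ₀⟩) (Ĵ := fun (θ : Θ) (ω : Ω) =>
    (∫ x, -ℓ 1 (D ω x) ∂empirical fun i => X i ξ)
      + ∫ z, -ℓ 0 (D ω (g θ z)) ∂empirical fun j => Z j ξ) hbdd (fun θ ω θ' ω' => ?_) hminθ
  linarith [hdev₁ ξ hξ.1 ω ω', hdev₂ ξ hξ.2 (ω, θ) (ω', θ')]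

end EstimationError

/-! ### Lipschitz constants of losses composed with the sigmoid -/

section Loss

lemma lipschitzOnWith_closedBall_of_hasDerivAt {h h' : ℝ → ℝ} (hd : ∀ t, HasDerivAt h (h' t) t)
    {Q : ℝ} {C : ℝ≥0} (hC : ∀ t, |t| ≤ Q → |h' t| ≤ C) :
    LipschitzOnWith C h (Metric.closedBall 0 Q) :=
  (convex_closedBall 0 Q).lipschitzOnWith_of_nnnorm_hasDerivWithin_le
    (fun t _ => (hd t).hasDerivWithinAt) fun t ht => hC t (mem_closedBall_zero_iff.1 ht)

lemma one_sub_sigmoid_pos (t : ℝ) : 0 < 1 - Real.sigmoid t := sub_pos.2 (Real.sigmoid_lt_one t)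

lemma sigmoid_mul_one_sub_le (t : ℝ) : Real.sigmoid t * (1 - Real.sigmoid t) ≤ 1 / 4 := by
  nlinarith [sq_nonneg (Real.sigmoid t - 1 / 2)]

lemma lipschitzWith_sigmoid : LipschitzWith (1 / 4) Real.sigmoid := by
  refine lipschitzWith_of_nnnorm_deriv_le
    (fun t => (Real.hasDerivAt_sigmoid t).differentiableAt) fun t => ?_
  rw [← NNReal.coe_le_coe, coe_nnnorm, (Real.hasDerivAt_sigmoid t).deriv, Real.norm_eq_abs,
    abs_of_pos (mul_pos (Real.sigmoid_pos t) (one_sub_sigmoid_pos t))]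
  simpa using sigmoid_mul_one_sub_le t

lemma sigmoid_mem_Icc (t : ℝ) : Real.sigmoid t ∈ Set.Icc (0 : ℝ) 1 :=
  ⟨Real.sigmoid_nonneg t, Real.sigmoid_le_one t⟩

lemma lipschitzWith_comp_sigmoid {u : ℝ → ℝ} {L : ℝ≥0} (hu : LipschitzOnWith L u (Set.Icc 0 1)) :
    LipschitzWith (L / 4) fun t => u (Real.sigmoid t) := by
  have h := hu.comp (lipschitzWith_sigmoid.lipschitzOnWith (s := Set.univ))
    fun t _ => sigmoid_mem_Icc t
  rwa [mul_one_div, lipschitzOnWith_univ] at h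

/-- The exponent `(α - 1) / α` of the `α`-loss, with its limit `1` at `α = ∞`. -/
def alphaExponent (α : ℝ≥0∞) : ℝ := if α = ⊤ then 1 else (α.toReal - 1) / α.toReal

lemma hasDerivAt_alphaPartialLoss {α : ℝ≥0∞} (hα : 0 < α) {t : ℝ} (ht : 0 < t) :
    HasDerivAt (alphaPartialLoss α) (-t ^ (alphaExponent α - 1)) t := by
  by_cases hone : α = 1
  · subst hone
    have hlog : alphaPartialLoss 1 = fun t => -Real.log t := funext fun t => if_pos rfl
    simpa [hlog, alphaExponent, Real.rpow_neg_one] using (Real.hasDerivAt_log ht.ne').fun_neg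
  by_cases htop : α = ⊤
  · subst htop
    have hlin : alphaPartialLoss ⊤ = fun t => 1 - t := funext fun t => by simp [alphaPartialLoss]
    simpa [hlin, alphaExponent] using (hasDerivAt_id t).const_sub 1
  have hα₀ : α.toReal ≠ 0 := (ENNReal.toReal_pos hα.ne' htop).ne'
  have hα₁ : α.toReal - 1 ≠ 0 := sub_ne_zero.2 fun h => hone ((ENNReal.toReal_eq_one_iff α).1 h)
  have hpow : alphaPartialLoss α = fun t =>
      α.toReal / (α.toReal - 1) * (1 - t ^ ((α.toReal - 1) / α.toReal)) :=
    funext fun t => by simp only [alphaPartialLoss, hone, htop, if_false]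
  simp only [hpow, alphaExponent, htop, if_false]
  refine (((Real.hasDerivAt_rpow_const (Or.inl ht.ne')).const_sub 1).const_mul _).congr_deriv ?_
  field_simp

lemma hasDerivAt_neg_alphaPartialLoss_sigmoid {α : ℝ≥0∞} (hα : 0 < α) (t : ℝ) :
    HasDerivAt (fun t => -alphaPartialLoss α (Real.sigmoid t))
      (Real.sigmoid t ^ alphaExponent α * (1 - Real.sigmoid t)) t := by
  have hσ := Real.sigmoid_pos t
  have hcomp := (hasDerivAt_alphaPartialLoss hα hσ).comp t (Real.hasDerivAt_sigmoid t)
  refine hcomp.fun_neg.congr_deriv ?_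
  rw [Real.rpow_sub_one hσ.ne']
  field_simp

lemma rpow_mul_one_sub_le {s β : ℝ} (hs : 0 ≤ s) (hs1 : s ≤ 1) (hβ : 0 < β) :
    s ^ β * (1 - s) ≤ (β / (1 + β)) ^ β * (1 / (1 + β)) := by
  have : 0 ≤ 1 - s := sub_nonneg.2 hs1
  -- AM-GM for `s` and `β * (1 - s)` with weights `β / (1 + β)` and `1 / (1 + β)`
  have hamgm : s ^ (β / (1 + β)) * (β * (1 - s)) ^ (1 / (1 + β)) ≤ β / (1 + β) := by
    refine (Real.geom_mean_le_arith_mean2_weighted (by positivity) (by positivity) hs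
      (by positivity) (by rw [← add_div, add_comm, div_self (by positivity)])).trans_eq ?_
    field_simp
    ring
  have hpow := Real.rpow_le_rpow (by positivity) hamgm (by positivity : 0 ≤ 1 + β)
  rw [Real.mul_rpow (by positivity) (by positivity), ← Real.rpow_mul hs,
    ← Real.rpow_mul (by positivity), div_mul_cancel₀ _ (by positivity),
    div_mul_cancel₀ _ (by positivity), Real.rpow_one, add_comm 1 β,
    Real.rpow_add_one (by positivity)] at hpow
  refine le_of_mul_le_mul_left ?_ hβ
  calc β * (s ^ β * (1 - s)) = s ^ β * (β * (1 - s)) := by ring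
    _ ≤ (β / (β + 1)) ^ β * (β / (β + 1)) := hpow
    _ = β * ((β / (1 + β)) ^ β * (1 / (1 + β))) := by rw [add_comm 1 β]; ring

lemma one_lt_toReal {α : ℝ≥0∞} (hα : ¬α ≤ 1) (htop : α ≠ ⊤) : 1 < α.toReal :=
  (ENNReal.toReal_lt_toReal ENNReal.one_ne_top htop).2 (not_le.1 hα)

lemma sigmoid_rpow_mul_one_sub_le_lipConst {α : ℝ≥0∞} (hα : 0 < α) {Q t : ℝ} (ht : |t| ≤ Q) :
    Real.sigmoid t ^ alphaExponent α * (1 - Real.sigmoid t) ≤ lipConst Q α := by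
  have hσ := Real.sigmoid_pos t
  by_cases htop : α = ⊤
  · simpa [htop, lipConst, alphaExponent] using sigmoid_mul_one_sub_le t
  have hα₀ : 0 < α.toReal := ENNReal.toReal_pos hα.ne' htop
  by_cases hle : α ≤ 1
  · have hα₁ : α.toReal ≤ 1 := ENNReal.toReal_mono ENNReal.one_ne_top hle
    simp only [lipConst, alphaExponent, hle, htop, if_true, if_false]
    rw [mul_comm, ← Real.sigmoid_neg]
    exact mul_le_mul (Real.sigmoid_le ((neg_le_abs t).trans ht))
      (Real.rpow_le_rpow_of_nonpos (Real.sigmoid_pos _) (Real.sigmoid_le (neg_le_of_abs_le ht))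
        (div_nonpos_of_nonpos_of_nonneg (sub_nonpos.2 hα₁) hα₀.le))
      (Real.rpow_nonneg hσ.le _) (Real.sigmoid_nonneg _)
  · have hα₁ := one_lt_toReal hle htop
    simp only [lipConst, alphaExponent, hle, htop, if_false]
    refine (rpow_mul_one_sub_le hσ.le (Real.sigmoid_le_one t)
      (div_pos (sub_pos.2 hα₁) hα₀)).trans_eq ?_
    have hden : 1 + (α.toReal - 1) / α.toReal = (2 * α.toReal - 1) / α.toReal := by
      field_simp
      ring
    rw [hden, div_div_div_cancel_right₀ hα₀.ne', one_div_div]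

lemma lipConst_nonneg (h : ℝ) (α : ℝ≥0∞) : 0 ≤ lipConst h α := by
  unfold lipConst
  split_ifs with hle htop
  · exact mul_nonneg (Real.sigmoid_nonneg _) (Real.rpow_nonneg (Real.sigmoid_nonneg _) _)
  · norm_num
  · have hα₁ := sub_pos.2 (one_lt_toReal hle htop)
    have hden : 0 < 2 * α.toReal - 1 := by linarith
    positivity

lemma continuous_neg_alphaPartialLoss_sigmoid {α : ℝ≥0∞} (hα : 0 < α) :
    Continuous fun t => -alphaPartialLoss α (Real.sigmoid t) :=
  continuous_iff_continuousAt.2 fun t =>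
    (hasDerivAt_neg_alphaPartialLoss_sigmoid hα t).continuousAt

lemma lipschitzOnWith_neg_alphaPartialLoss_sigmoid {α : ℝ≥0∞} (hα : 0 < α) {Q : ℝ} :
    LipschitzOnWith (lipConst Q α).toNNReal (fun t => -alphaPartialLoss α (Real.sigmoid t))
      (Metric.closedBall 0 Q) := by
  refine lipschitzOnWith_closedBall_of_hasDerivAt
    (hasDerivAt_neg_alphaPartialLoss_sigmoid hα) fun t ht => ?_
  rw [abs_of_pos (mul_pos (Real.rpow_pos_of_pos (Real.sigmoid_pos t) _) (one_sub_sigmoid_pos t))]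
  exact (sigmoid_rpow_mul_one_sub_le_lipConst hα ht).trans (Real.le_coe_toNNReal _)

lemma alphaLoss_one_sigmoid (α : ℝ≥0∞) (t : ℝ) :
    alphaLoss α 1 (Real.sigmoid t) = alphaPartialLoss α (Real.sigmoid t) := by simp [alphaLoss]

lemma alphaLoss_zero_sigmoid (α : ℝ≥0∞) (t : ℝ) :
    alphaLoss α 0 (Real.sigmoid t) = alphaPartialLoss α (Real.sigmoid (-t)) := by
  simp [alphaLoss, Real.sigmoid_neg]

lemma continuous_neg_alphaLoss_sigmoid {α : ℝ≥0∞} (hα : 0 < α) (y : Fin 2) :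
    Continuous fun t => -alphaLoss α y (Real.sigmoid t) := by
  have hcont := continuous_neg_alphaPartialLoss_sigmoid hα
  match y with
  | 0 => simpa only [alphaLoss_zero_sigmoid, Function.comp_def] using hcont.comp continuous_neg
  | 1 => simpa only [alphaLoss_one_sigmoid] using hcont

lemma lipschitzOnWith_neg_alphaLoss_sigmoid {α : ℝ≥0∞} (hα : 0 < α) (y : Fin 2) (Q : ℝ) :
    LipschitzOnWith (lipConst Q α).toNNReal (fun t => -alphaLoss α y (Real.sigmoid t))
      (Metric.closedBall 0 Q) := by
  have hLip := lipschitzOnWith_neg_alphaPartialLoss_sigmoid hα (Q := Q)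
  match y with
  | 0 =>
    simp only [alphaLoss_zero_sigmoid]
    intro t ht u hu
    simpa using hLip (x := -t) (by simpa using ht) (y := -u) (by simpa using hu)
  | 1 => simpa only [alphaLoss_one_sigmoid] using hLip

end Loss

/-! ### Estimation error of adversarially trained networks -/

section Estimation

lemma HasExpMomentBound.abs_integral_comp_le {T H : Type*} [NormedAddCommGroup H]
    [InnerProductSpace ℝ H] [MeasurableSpace H] {P : Measure H} [IsProbabilityMeasure P]
    {f : T → H → ℝ} {A B : ℝ} {K : ℕ} {C : ℝ≥0} {h : ℝ → ℝ} (hf : HasExpMomentBound f A K)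
    (hA : 0 ≤ A) (hB : ∀ᵐ x ∂P, ‖x‖ ≤ B)
    (hLip : LipschitzOnWith C h (Metric.closedBall 0 (A * B))) (t : T) :
    |∫ x, h (f t x) ∂P| ≤ |h 0| + C * (A * B) := by
  have hbound : ∀ᵐ x ∂P, ‖h (f t x)‖ ≤ |h 0| + C * (A * B) := hB.mono fun x hx =>
    (abs_sub_le_iff.1 (abs_abs_sub_abs_le (h (f t x)) (h 0))).1.trans
      (hf.abs_comp_sub_le hA hLip t hx) |> sub_le_iff_le_add'.1
  simpa using norm_integral_le_of_norm_le_const hbound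

variable {k l : ℕ} {p q : ℕ → ℕ} {r : Fin (k - 1) → ℝ → ℝ} {R : Fin (k - 1) → ℝ≥0}
  {M : Fin (k - 1) → ℝ} {Mk : ℝ} {Ω : Set (DiscParam p k)}
  {s : Fin (l - 1) → ℝ → ℝ} {S : Fin (l - 1) → ℝ≥0} {N : Fin (l - 1) → ℝ} {Nl : ℝ}
  {Θ : Set (GenParam q l (p 0))} {Pr : Measure (EuclideanSpace ℝ (Fin (p 0)))}
  {PZ : Measure (EuclideanSpace ℝ (Fin (q 0)))} {Ξ : Type*} [MeasurableSpace Ξ] {μ : Measure Ξ}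
  {n m : ℕ} {X : Fin n → Ξ → EuclideanSpace ℝ (Fin (p 0))}
  {Z : Fin m → Ξ → EuclideanSpace ℝ (Fin (q 0))} {δ Bx Bz : ℝ} {C Cφ Cψ : ℝ≥0} {h : ℝ → ℝ}

lemma uniformDeviationBound_comp_discLogit [IsProbabilityMeasure Pr] (hk : 1 ≤ k)
    (hrLip : ∀ i, LipschitzWith (R i) (r i)) (hrHom : ∀ i, PosHomogeneous (r i))
    (hΩne : Ω.Nonempty) (hΩ : Ω ⊆ discBall p k M Mk) (hB : ∀ᵐ x ∂Pr, ‖x‖ ≤ Bx) (hn : 0 < n)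
    (hX : ∀ i, HasLaw (X i) Pr μ) (hind : iIndepFun X μ) (hδ : 0 < δ) (hδ1 : δ ≤ 1)
    (hh : Continuous h)
    (hLip : LipschitzOnWith C h (Metric.closedBall 0 ((Mk * ∏ i, M i * R i) * Bx))) :
    UniformDeviationBound (fun (ω : Ω) x => h (discLogit p k r ω x)) Pr μ X δ
      (4 * (C * ((Mk * ∏ i, M i * R i) * Bx)) * √(3 * k) / √n
        + 2 * √(2 * Real.log (1 / δ)) * (C * ((Mk * ∏ i, M i * R i) * Bx) / √n)) := by
  have := hΩne.to_subtype
  have hr (i) : Continuous (r i) := (hrLip i).continuous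
  have hf := hasExpMomentBound_discLogit hrLip hrHom fun ω : Ω => hΩ ω.2
  have hbound := hf.uniformDeviationBound hX hind hn hδ hδ1
    (mul_prod_nonneg_of_mem_discBall (hΩ hΩne.some_mem) R) hB
    (fun ω => continuous_discLogit hr continuous_const continuous_id)
    (fun x => continuous_discLogit hr continuous_subtype_val continuous_const) hh hLip
  rwa [Nat.cast_sub hk, Nat.cast_one, sub_add_cancel] at hbound

lemma uniformDeviationBound_comp_discLogit_gen [IsProbabilityMeasure PZ] (hk : 1 ≤ k) (hl : 1 ≤ l)
    (hrLip : ∀ i, LipschitzWith (R i) (r i)) (hrHom : ∀ i, PosHomogeneous (r i))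
    (hΩne : Ω.Nonempty) (hΩ : Ω ⊆ discBall p k M Mk)
    (hsLip : ∀ j, LipschitzWith (S j) (s j)) (hsHom : ∀ j, PosHomogeneous (s j))
    (hΘne : Θ.Nonempty) (hΘ : Θ ⊆ genBall q l (p 0) N Nl) (hB : ∀ᵐ z ∂PZ, ‖z‖ ≤ Bz) (hm : 0 < m)
    (hZ : ∀ j, HasLaw (Z j) PZ μ) (hind : iIndepFun Z μ) (hδ : 0 < δ) (hδ1 : δ ≤ 1)
    (hh : Continuous h) (hLip : LipschitzOnWith C h
      (Metric.closedBall 0 ((Mk * ∏ i, M i * R i) * (Nl * ∏ j, N j * S j) * Bz))) :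
    UniformDeviationBound
      (fun (t : Ω × Θ) z => h (discLogit p k r t.1 (gen q l (p 0) s t.2 z))) PZ μ Z δ
      (4 * (C * ((Mk * ∏ i, M i * R i) * (Nl * ∏ j, N j * S j) * Bz)) * √(3 * (k + l - 1)) / √m
        + 2 * √(2 * Real.log (1 / δ))
          * (C * ((Mk * ∏ i, M i * R i) * (Nl * ∏ j, N j * S j) * Bz) / √m)) := by
  have := hΩne.to_subtype
  have := hΘne.to_subtype
  have hr (i) : Continuous (r i) := (hrLip i).continuous
  have hs (j) : Continuous (s j) := (hsLip j).continuous
  have hf := hasExpMomentBound_discLogit_gen hrLip hrHom (fun t : Ω × Θ => hΩ t.1.2) hsLip hsHom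
    fun t => hΘ t.2.2
  have hbound := hf.uniformDeviationBound hZ hind hm hδ hδ1
    (mul_nonneg (mul_prod_nonneg_of_mem_discBall (hΩ hΩne.some_mem) R)
      (mul_prod_nonneg_of_mem_genBall (hΘ hΘne.some_mem) S)) hB
    (fun t => continuous_discLogit hr continuous_const (continuous_gen hs continuous_const
      continuous_id))
    (fun z => continuous_discLogit hr (continuous_subtype_val.comp continuous_fst)
      (continuous_gen hs (continuous_subtype_val.comp continuous_snd) continuous_const)) hh hLip
  convert hbound using 6
  push_cast [Nat.cast_sub hk, Nat.cast_sub hl]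
  ring_nf

lemma bddAbove_range_integral_add_integral [IsProbabilityMeasure Pr] [IsProbabilityMeasure PZ]
    {φ ψ : ℝ → ℝ} (hrLip : ∀ i, LipschitzWith (R i) (r i)) (hrHom : ∀ i, PosHomogeneous (r i))
    (hΩ : Ω ⊆ discBall p k M Mk) (hsLip : ∀ j, LipschitzWith (S j) (s j))
    (hsHom : ∀ j, PosHomogeneous (s j)) (hΘ : Θ ⊆ genBall q l (p 0) N Nl)
    (hBx : ∀ᵐ x ∂Pr, ‖x‖ ≤ Bx) (hBz : ∀ᵐ z ∂PZ, ‖z‖ ≤ Bz)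
    (hφLip : LipschitzOnWith Cφ φ (Metric.closedBall 0 ((Mk * ∏ i, M i * R i) * Bx)))
    (hψLip : LipschitzOnWith Cψ ψ
      (Metric.closedBall 0 ((Mk * ∏ i, M i * R i) * (Nl * ∏ j, N j * S j) * Bz))) (θ : Θ) :
    BddAbove (Set.range fun ω : Ω => (∫ x, φ (discLogit p k r ω x) ∂Pr)
      + ∫ z, ψ (discLogit p k r ω (gen q l (p 0) s θ z)) ∂PZ) := by
  refine ⟨(|φ 0| + Cφ * ((Mk * ∏ i, M i * R i) * Bx)) + (|ψ 0|
    + Cψ * ((Mk * ∏ i, M i * R i) * (Nl * ∏ j, N j * S j) * Bz)),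
    Set.forall_mem_range.2 fun ω => ?_⟩
  have : Nonempty Ω := ⟨ω⟩
  have hA := mul_prod_nonneg_of_mem_discBall (hΩ ω.2) R
  exact add_le_add
    ((le_abs_self _).trans ((hasExpMomentBound_discLogit hrLip hrHom
      fun ω : Ω => hΩ ω.2).abs_integral_comp_le hA hBx hφLip ω))
    ((le_abs_self _).trans ((hasExpMomentBound_discLogit_gen hrLip hrHom (fun ω : Ω => hΩ ω.2)
      hsLip hsHom fun _ => hΘ θ.2).abs_integral_comp_le
        (mul_nonneg hA (mul_prod_nonneg_of_mem_genBall (hΘ θ.2) S)) hBz hψLip ω))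

lemma estimationErrorBound_of_lipschitzOnWith_comp_sigmoid [IsProbabilityMeasure Pr]
    [IsProbabilityMeasure PZ] [IsProbabilityMeasure μ] (hk : 1 ≤ k) (hl : 1 ≤ l)
    (hrLip : ∀ i, LipschitzWith (R i) (r i)) (hrHom : ∀ i, PosHomogeneous (r i))
    (hΩne : Ω.Nonempty) (hΩ : Ω ⊆ discBall p k M Mk)
    (hsLip : ∀ j, LipschitzWith (S j) (s j)) (hsHom : ∀ j, PosHomogeneous (s j))
    (hΘne : Θ.Nonempty) (hΘ : Θ ⊆ genBall q l (p 0) N Nl)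
    (hBx : ∀ᵐ x ∂Pr, ‖x‖ ≤ Bx) (hBz : ∀ᵐ z ∂PZ, ‖z‖ ≤ Bz) (hn : 0 < n) (hm : 0 < m)
    (hX : ∀ i, HasLaw (X i) Pr μ) (hXind : iIndepFun X μ)
    (hZ : ∀ j, HasLaw (Z j) PZ μ) (hZind : iIndepFun Z μ) (hδ : 0 < δ) (hδ1 : δ ≤ 1)
    {Qx Qz : ℝ} (hQx : Qx = Mk * (∏ i, M i * R i) * Bx)
    (hQz : Qz = (Mk * ∏ i, M i * R i) * (Nl * ∏ j, N j * S j) * Bz) {ℓ : CPELoss}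
    (hφ : Continuous fun t => -ℓ 1 (Real.sigmoid t))
    (hψ : Continuous fun t => -ℓ 0 (Real.sigmoid t))
    (hφLip : LipschitzOnWith Cφ (fun t => -ℓ 1 (Real.sigmoid t)) (Metric.closedBall 0 Qx))
    (hψLip : LipschitzOnWith Cψ (fun t => -ℓ 0 (Real.sigmoid t)) (Metric.closedBall 0 Qz)) :
    EstimationErrorBound ℓ (disc p k r) Ω (gen q l (p 0) s) Θ Pr PZ μ X Z δ
      (4 * Cφ * Qx * √(3 * k) / √n + 4 * Cψ * Qz * √(3 * (k + l - 1)) / √m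
        + 2 * √(2 * Real.log (1 / δ)) * (Cφ * Qx / √n + Cψ * Qz / √m)) := by
  subst hQx hQz
  have hgen (θ : GenParam q l (p 0)) : Continuous (gen q l (p 0) s θ) :=
    continuous_gen (fun j => (hsLip j).continuous) continuous_const continuous_id
  have hdisc (ω : DiscParam p k) : Continuous fun x => -ℓ 0 (disc p k r ω x) := hψ.comp
    (continuous_discLogit (fun i => (hrLip i).continuous) continuous_const continuous_id)
  have hbound := estimationErrorBound_of_uniformDeviationBound (D := disc p k r)
    (g := gen q l (p 0) s) hΩne (fun θ => (hgen θ).measurable) (fun ω => (hdisc ω).measurable)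
    (bddAbove_range_integral_add_integral (φ := fun t => -ℓ 1 (Real.sigmoid t))
      (ψ := fun t => -ℓ 0 (Real.sigmoid t)) hrLip hrHom hΩ hsLip hsHom hΘ hBx hBz hφLip hψLip)
    (uniformDeviationBound_comp_discLogit (h := fun t => -ℓ 1 (Real.sigmoid t)) hk hrLip hrHom hΩne
      hΩ hBx hn hX hXind hδ hδ1 hφ hφLip)
    (uniformDeviationBound_comp_discLogit_gen (h := fun t => -ℓ 0 (Real.sigmoid t)) hk hl hrLip
      hrHom hΩne hΩ hsLip hsHom hΘne hΘ hBz hm hZ hZind hδ hδ1 hψ hψLip)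
  convert hbound using 1
  ring

lemma sqrt_mul_div_sqrt_two_mul (a L Q x : ℝ) :
    √a * (L * Q / √(2 * x)) = 2 * √(2 * a) * (L / 4 * Q / √x) := by
  rw [Real.sqrt_mul zero_le_two, Real.sqrt_mul zero_le_two]
  have hinv : (√2 : ℝ)⁻¹ = √2 / 2 := by rw [Real.sqrt_div_self', one_div]
  simp only [div_eq_mul_inv _ (_ * _), mul_inv, hinv]
  ring

end Estimation

end CPEGAN

end

theorem mainTheorem6
    -- discriminator: `k` layers, widths `p`, activations `r i` that are `R i`-Lipschitz
    (k : ℕ) (hk : 1 ≤ k) (p : ℕ → ℕ) (r : Fin (k - 1) → ℝ → ℝ) (R : Fin (k - 1) → ℝ≥0)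
    (hrLip : ∀ i, LipschitzWith (R i) (r i)) (hrHom : ∀ i, CPEGAN.PosHomogeneous (r i))
    (M : Fin (k - 1) → ℝ) (Mk : ℝ)
    (Ω : Set (CPEGAN.DiscParam p k)) (hΩne : Ω.Nonempty) (hΩ : Ω ⊆ CPEGAN.discBall p k M Mk)
    -- generator: `l` layers, widths `q`, activations `s j` that are `S j`-Lipschitz
    (l : ℕ) (hl : 1 ≤ l) (q : ℕ → ℕ) (s : Fin (l - 1) → ℝ → ℝ) (S : Fin (l - 1) → ℝ≥0)
    (hsLip : ∀ j, LipschitzWith (S j) (s j)) (hsHom : ∀ j, CPEGAN.PosHomogeneous (s j))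
    (N : Fin (l - 1) → ℝ) (Nl : ℝ)
    (Θ : Set (CPEGAN.GenParam q l (p 0))) (hΘne : Θ.Nonempty)
    (hΘ : Θ ⊆ CPEGAN.genBall q l (p 0) N Nl)
    -- real data and latent noise, with bounded supports
    (Pr : Measure (EuclideanSpace ℝ (Fin (p 0)))) [IsProbabilityMeasure Pr]
    (PZ : Measure (EuclideanSpace ℝ (Fin (q 0)))) [IsProbabilityMeasure PZ]
    (Bx Bz : ℝ) (hBx : ∀ᵐ x ∂Pr, ‖x‖ ≤ Bx) (hBz : ∀ᵐ z ∂PZ, ‖z‖ ≤ Bz)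
    -- training samples
    {Ξ : Type*} [MeasurableSpace Ξ] (μ : Measure Ξ) [IsProbabilityMeasure μ]
    (n m : ℕ) (hn : 1 ≤ n) (hm : 1 ≤ m)
    (X : Fin n → Ξ → EuclideanSpace ℝ (Fin (p 0))) (hXlaw : ∀ i, HasLaw (X i) Pr μ)
    (hXind : iIndepFun X μ)
    (Z : Fin m → Ξ → EuclideanSpace ℝ (Fin (q 0))) (hZlaw : ∀ j, HasLaw (Z j) PZ μ)
    (hZind : iIndepFun Z μ)
    (δ : ℝ) (hδ : 0 < δ) (hδ1 : δ < 1)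
    (Qx Qz : ℝ) (hQx : Qx = Mk * (∏ i, M i * R i) * Bx)
    (hQz : Qz = (Mk * ∏ i, M i * R i) * (Nl * ∏ j, N j * S j) * Bz) :
    -- any CPE loss with Lipschitz `φ = -ℓ(1, ·)` and `ψ = -ℓ(0, ·)`
    (∀ (ℓ : CPEGAN.CPELoss) (Lφ Lψ : ℝ≥0),
      LipschitzOnWith Lφ (fun t => -ℓ 1 t) (Set.Icc 0 1) →
      LipschitzOnWith Lψ (fun t => -ℓ 0 t) (Set.Icc 0 1) →
      CPEGAN.EstimationErrorBound ℓ (CPEGAN.disc p k r) Ω (CPEGAN.gen q l (p 0) s) Θ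
        Pr PZ μ X Z δ
        (Lφ * Qx * √(3 * k) / √n + Lψ * Qz * √(3 * ((k : ℝ) + l - 1)) / √m
          + √(Real.log (1 / δ)) * (Lφ * Qx / √(2 * n) + Lψ * Qz / √(2 * m)))) ∧
    -- the `α`-GAN
    (∀ α : ℝ≥0∞, 0 < α →
      CPEGAN.EstimationErrorBound (CPEGAN.alphaLoss α) (CPEGAN.disc p k r) Ω
        (CPEGAN.gen q l (p 0) s) Θ Pr PZ μ X Z δ
        (4 * CPEGAN.lipConst Qx α * Qx * √(3 * k) / √n
          + 4 * CPEGAN.lipConst Qz α * Qz * √(3 * ((k : ℝ) + l - 1)) / √m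
          + 2 * √(2 * Real.log (1 / δ))
            * (CPEGAN.lipConst Qx α * Qx / √n + CPEGAN.lipConst Qz α * Qz / √m))) := by
  refine ⟨fun ℓ Lφ Lψ hφ hψ => ?_, fun α hα => ?_⟩
  · have hφσ := CPEGAN.lipschitzWith_comp_sigmoid hφ
    have hψσ := CPEGAN.lipschitzWith_comp_sigmoid hψ
    have hbound := CPEGAN.estimationErrorBound_of_lipschitzOnWith_comp_sigmoid hk hl hrLip hrHom
      hΩne hΩ hsLip hsHom hΘne hΘ hBx hBz hn hm hXlaw hXind hZlaw hZind hδ hδ1.le hQx hQz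
      hφσ.continuous hψσ.continuous hφσ.lipschitzOnWith hψσ.lipschitzOnWith
    convert hbound using 1
    push_cast
    rw [mul_add, CPEGAN.sqrt_mul_div_sqrt_two_mul, CPEGAN.sqrt_mul_div_sqrt_two_mul]
    ring
  · have hbound := CPEGAN.estimationErrorBound_of_lipschitzOnWith_comp_sigmoid hk hl hrLip hrHom
      hΩne hΩ hsLip hsHom hΘne hΘ hBx hBz hn hm hXlaw hXind hZlaw hZind hδ hδ1.le hQx hQz
      (CPEGAN.continuous_neg_alphaLoss_sigmoid hα 1) (CPEGAN.continuous_neg_alphaLoss_sigmoid hα 0)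
      (CPEGAN.lipschitzOnWith_neg_alphaLoss_sigmoid hα 1 Qx)
      (CPEGAN.lipschitzOnWith_neg_alphaLoss_sigmoid hα 0 Qz)
    simpa only [Real.coe_toNNReal _ (CPEGAN.lipConst_nonneg _ α)] using hbound
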